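/- Setting. Let $\mathcal T$ be a finite simplicial complex with flat cells in a real normed space (for instance $\mathbb R^3$) that triangulates a closed oriented surface $\Gamma_h$: every cell is a cell of a triangle, every edge lies in exactly two triangles, the link of every vertex is connected, and the triangles are coherently oriented. Let $\mathcal T^r$ be the set of its cells of dimension $r$, each with an arbitrarily chosen orientation, and $D_{st}^r\in\{-1,0,1\}$ the incidence numbers of $s\in\mathcal T^r$, $t\in\mathcal T^{r+1}$. Let $\widetilde{\mathcal T}$ be the barycentric refinement of $\mathcal T$, and let $\tilde\lambda_w^q$, $w\in\widetilde{\mathcal T}^q$, be the standard basis of Whitney $q$-forms on it, where $\tilde\lambda^q_{[x_0,\dots,x_q]}=q!\sum_i(-1)^i\lambda_{x_i}\,d\lambda_{x_0}\wedge\cdots\widehat{d\lambda_{x_i}}\cdots\wedge d\lambda_{x_q}$ with $\lambda_x$ the barycentric coordinate functions, and $d$ is the exterior derivative, taken triangle by triangle; let $\widetilde D_{wz}^q$ be the incidence numbers of $\widetilde{\mathcal T}$. Let $\mathcal V$ be the barycentric dual of $\mathcal T$, with cells $v=\star t\in\mathcal V^q$ for $t\in\mathcal T^{2-q}$, oriented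 such that $(\star t,t)$ is in the orientation of the surface, and write $v=\sum_{w\in\widetilde{\mathcal T}^q}c_{vw}^q\,w$ with $c^q_{vw}\in\{-1,0,1\}$ and $n_v=\sum_w|c_{vw}^q|$. For $v\in\mathcal V^2$ let $U_v^2=\overline v$, and for $q=1,0$ and $v\in\mathcal V^q$ let $U_v^q$ be the union of all $U_u^{q+1}$, $u\in\mathcal V^{q+1}$, with $v$ in the boundary of $u$. The Buffa--Christiansen (B-C) forms are $\mu_v^q=\sum_{w\in\widetilde{\mathcal T}^q}R_{vw}^q\,\tilde\lambda_w^q$, $v\in\mathcal V^q$, $q=0,1,2$, with real coefficients that satisfy: (1) $R_{vw}^q=0$ if $w\not\subset U_v^q$ or $w\subset\partial U_v^q$; (2) $R_{vw}^q=c_{vw}^q/n_v$ if $c_{vw}^q\neq0$; (3) $R_{\star t,w}^1=0$ if $t\in\mathcal T^1$, $w\in\widetilde{\mathcal T}^1$ and $w\subset t$; (4) $\sum_{w}R_{\star t,w}^1\widetilde D_{wz}^1=\sum_{s\in\mathcal T^0}D_{st}^0R_{\star s,z}^2$ for all $t\in\mathcal T^1$ and all $z\in\widetilde{\mathcal T}^2$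 with $z\subset U_{\star t}^1$, and $\sum_{w}R_{\star t,w}^0\widetilde D_{wz}^0=-\sum_{s\in\mathcal T^1}D_{st}^1R_{\star s,z}^1$ for all $t\in\mathcal T^2$ and all $z\in\widetilde{\mathcal T}^1$ contained in the closed triangle $t$. Proposition (Complex Property). There is exactly one choice of coefficients $R_{vw}^q$ that satisfies (1)--(4). For this choice, the B-C spaces $\mathcal B^q=\mathrm{span}\{\mu_v^q: v\in\mathcal V^q\}$ form a discrete de Rham complex $$0\to\mathcal B^0\xrightarrow{d}\mathcal B^1\xrightarrow{d}\mathcal B^2\xrightarrow{d}0,$$ that is, $d\mathcal B^q\subset\mathcal B^{q+1}$ for $q=0,1$, $d\circ d=0$ and $d\mathcal B^2=0$. The dimension of its $q$-th cohomology group equals the $q$-th Betti number of $\Gamma_h$, that is, the dimension of the $q$-th simplicial homology of $\mathcal T$ with real coefficients. -/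

import Mathlib

open scoped Nat

noncomputable section

/-- Smooth differential `q`-forms on a normed space. -/
def SmoothForm (V : Type*) [NormedAddCommGroup V] [NormedSpace ℝ V] (q : ℕ) :
    Submodule ℝ (V → V [⋀^Fin q]→L[ℝ] ℝ) where
  carrier := {ω | ContDiff ℝ ((⊤ : ℕ∞) : WithTop ℕ∞) ω}
  add_mem' {ω η} h h' := by
    rw [Set.mem_ofPred_eq] at h h' ⊢
    exact h.add h'
  zero_mem' := by
    rw [Set.mem_ofPred_eq]
    exact contDiff_const
  smul_mem' c ω h := by
    rw [Set.mem_ofPred_eq] at h ⊢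
    exact h.const_smul c

namespace SmoothForm

variable {V : Type*} [NormedAddCommGroup V] [NormedSpace ℝ V] {q : ℕ}

theorem contDiff_coe (ω : SmoothForm V q) : ContDiff ℝ ((⊤ : ℕ∞) : WithTop ℕ∞) ω.1 := ω.2

theorem contDiff_extDeriv (ω : SmoothForm V q) :
    ContDiff ℝ ((⊤ : ℕ∞) : WithTop ℕ∞) (extDeriv ω.1) := by
  have h : extDeriv ω.1 = fun x =>
      ContinuousAlternatingMap.alternatizeUncurryFinCLM ℝ V ℝ (fderiv ℝ ω.1 x) :=
    funext fun x => (ContinuousAlternatingMap.alternatizeUncurryFinCLM_apply _).symm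
  rw [h]
  exact (ContinuousLinearMap.contDiff _).comp
    ((contDiff_coe ω).fderiv_right (m := ((⊤ : ℕ∞) : WithTop ℕ∞)) (by simp))

/-- The exterior derivative. -/
def d : SmoothForm V q →ₗ[ℝ] SmoothForm V (q + 1) where
  toFun ω := ⟨extDeriv ω.1, contDiff_extDeriv ω⟩
  map_add' ω η := Subtype.ext <| funext fun _ =>
    extDeriv_add ((contDiff_coe ω).differentiable (by simp) _)
      ((contDiff_coe η).differentiable (by simp) _)
  map_smul' c ω := Subtype.ext <| funext fun _ => extDeriv_smul c ω.1

end SmoothForm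

/-- The wedge product of covectors, `(ℓ₀ ∧ ⋯ ∧ ℓ_{q-1}) v = det (ℓᵢ (vⱼ))`. -/
def wedge {V : Type*} [NormedAddCommGroup V] [NormedSpace ℝ V] {q : ℕ} (l : Fin q → V →L[ℝ] ℝ) :
    V [⋀^Fin q]→L[ℝ] ℝ :=
  ContinuousMultilinearMap.alternatization
    ((ContinuousMultilinearMap.mkPiAlgebra ℝ (Fin q) ℝ).compContinuousLinearMap l)

theorem wedge_apply {V : Type*} [NormedAddCommGroup V] [NormedSpace ℝ V] {q : ℕ}
    (l : Fin q → V →L[ℝ] ℝ) (v : Fin q → V) :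
    wedge l v = (Matrix.of fun i j => l i (v j)).det := by
  rw [← Matrix.det_transpose]
  simp [wedge, ContinuousMultilinearMap.alternatization_apply_apply, Matrix.det_apply]

/-- The sign of the permutation that sorts three distinct nodes by their numbers. -/
def sortSign {E : Type*} (num : E → ℕ) (a b c : E) : ℤ :=
  ((num b : ℤ) - num a).sign * ((num c : ℤ) - num a).sign * ((num c : ℤ) - num b).sign

/-- A finite triangulation of a closed oriented surface, with flat cells in a real normed space `E`
(for instance `E = ℝ³`): the mesh of the discretized interface, together with the choices of
orientation that are needed to speak of incidence numbers. -/
structure InterfaceMesh (E : Type*) [NormedAddCommGroup E] [NormedSpace ℝ E] extends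
    Geometry.SimplicialComplex ℝ E where
  finite_faces : faces.Finite
  /-- The mesh is two-dimensional: every cell is a cell of some triangle. -/
  exists_facet : ∀ s ∈ faces, ∃ f ∈ faces, f.card = 3 ∧ s ⊆ f
  /-- There is no boundary: every edge is contained in exactly two triangles. -/
  edge_two_facets : ∀ e ∈ faces, e.card = 2 →
    {f | f ∈ faces ∧ f.card = 3 ∧ e ⊆ f}.ncard = 2
  /-- The link of every vertex is connected, so that the underlying space is a surface: any two
  triangles at a vertex `p` are joined by triangles at `p`, each sharing an edge `{p, b}` with the
  next. -/
  link_connected : ∀ p : E, ∀ f ∈ faces, ∀ g ∈ faces, f.card = 3 → g.card = 3 → p ∈ f → p ∈ g →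
    Relation.ReflTransGen (fun s t : Finset E =>
      t ∈ faces ∧ t.card = 3 ∧ p ∈ t ∧ ∃ b, b ≠ p ∧ b ∈ s ∧ b ∈ t) f g
  /-- A numbering of the nodes; it gives every cell a reference orientation. -/
  num : E → ℕ
  num_injOn : Set.InjOn num {p | {p} ∈ faces}
  /-- The (arbitrary) orientation of each cell of the mesh, relative to the reference one. -/
  cellSign : Finset E → ℤˣ
  /-- The orientation of the surface on each triangle, relative to the reference one. -/
  surfaceSign : Finset E → ℤˣ
  /-- The orientations of two triangles that share the edge `{a, b}` agree: they induce
  opposite orientations on the edge. -/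
  coherent : ∀ a b c d : E, c ≠ d → ∀ f ∈ faces, ∀ g ∈ faces, f.card = 3 → g.card = 3 →
    (f : Set E) = {a, b, c} → (g : Set E) = {a, b, d} →
    surfaceSign f * sortSign num a b c = -(surfaceSign g * sortSign num a b d)

namespace InterfaceMesh

variable {E : Type*} [NormedAddCommGroup E] [NormedSpace ℝ E] (T : InterfaceMesh E)

/-! ### Primal cells, incidence numbers, Betti numbers -/

/-- The cells of dimension `k` of the mesh. -/
abbrev Cell (k : ℕ) : Type _ := {t : Finset E // t ∈ T.faces ∧ t.card = k + 1}

instance finite_face : Finite T.faces := T.finite_faces.to_subtype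

instance (k : ℕ) : Finite (T.Cell k) :=
  Finite.of_injective (β := T.faces) (fun t => ⟨t.1, t.2.1⟩)
    (fun _ _ h => Subtype.ext (congrArg (fun x : T.faces => x.1) h))

instance (k : ℕ) : Fintype (T.Cell k) := Fintype.ofFinite _

open Classical in
/-- The incidence number `D s t` of two cells with `dim t = dim s + 1`: if `s` arises from `t` by
deleting its `i`-th vertex, it is `(-1) ^ i`, corrected by the orientations of `s` and `t`. -/
def incidence (s t : Finset E) : ℤ :=
  T.cellSign s * T.cellSign t *
    ∑ v ∈ t, if t.erase v = s then (-1) ^ (t.filter fun u => T.num u < T.num v).card else 0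

/-- The boundary operator on real simplicial chains, `∂ t = ∑ s, D s t • s`. -/
def boundary (k : ℕ) : (T.Cell (k + 1) → ℝ) →ₗ[ℝ] (T.Cell k → ℝ) :=
  Matrix.mulVecLin (Matrix.of fun s t => (T.incidence s.1 t.1 : ℝ))

/-- Simplicial cycles. -/
def cycles : (k : ℕ) → Submodule ℝ (T.Cell k → ℝ)
  | 0 => ⊤
  | k + 1 => LinearMap.ker (T.boundary k)

/-- The `k`-th Betti number: the dimension of the `k`-th real simplicial homology. -/
def betti (k : ℕ) : ℕ :=
  Module.finrank ℝ
    (T.cycles k ⧸ (LinearMap.range (T.boundary k)).submoduleOf (T.cycles k))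

/-! ### The barycentric refinement and the barycentric dual -/

/-- The cells of dimension `q` of the barycentric refinement: chains `σ₀ ⊂ ⋯ ⊂ σ_q` of cells of
the mesh. The cell is the simplex spanned by the barycenters of the `σᵢ`, oriented by this
order. -/
abbrev FineCell (q : ℕ) : Type _ := Fin (q + 1) ↪o T.faces

instance (q : ℕ) : Finite (T.FineCell q) := DFunLike.finite _

instance (q : ℕ) : Fintype (T.FineCell q) := Fintype.ofFinite _

/-- The face of a cell of the refinement opposite to its `i`-th vertex. -/
def FineCell.face {T : InterfaceMesh E} {q : ℕ} (z : T.FineCell (q + 1)) (i : Fin (q + 2)) :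
    T.FineCell q :=
  (Fin.succAboveOrderEmb i).trans z

/-- The vertices of a cell of the refinement. -/
def FineCell.point {T : InterfaceMesh E} {q : ℕ} (z : T.FineCell q) (i : Fin (q + 1)) : E :=
  (z i).1.centroid ℝ id

/-- The cells of dimension `q` of the barycentric dual. They are in bijection with the mesh cells
of dimension `2 - q`, and the dual cell `⋆t` is represented by `t`. -/
abbrev DualCell (q : ℕ) : Type _ := {t : Finset E // t ∈ T.faces ∧ t.card + q = 3}

instance (q : ℕ) : Finite (T.DualCell q) :=
  Finite.of_injective (β := T.faces) (fun t => ⟨t.1, t.2.1⟩)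
    (fun _ _ h => Subtype.ext (congrArg (fun x : T.faces => x.1) h))

instance (q : ℕ) : Fintype (T.DualCell q) := Fintype.ofFinite _

/-- The orientation, `1` or `-1`, of the ordered triangle `a, b, c` in the oriented surface, where
`f` is the triangle with vertices `a, b, c`. -/
def orient (f : Finset E) (a b c : E) : ℤ :=
  T.surfaceSign f * sortSign T.num a b c

open Classical in
/-- For a cell `w` of the refinement contained in `⋆t`, where `t = w 0` has the reference
orientation: the sign of `w` in `⋆t`, where `⋆t` is oriented such that `(⋆t, t)` is in the
orientation of the surface. Each sum has one term. For `q = 1`, `t` is the edge from `a` to `b`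
and `c` is the opposite vertex of the triangle `w 1`: `w` points towards `c`, and the frame
`(c - a, b - a)` has the orientation of the triangle `a, c, b`. -/
def dualSign : (q : ℕ) → T.FineCell q → ℤ
  | 0, w => T.surfaceSign (w 0).1
  | 1, w => ∑ a ∈ (w 0).1, ∑ b ∈ (w 0).1.filter (fun b => T.num a < T.num b),
      ∑ c ∈ (w 1).1 \ (w 0).1, T.orient (w 1).1 a c b
  | 2, w => ∑ a ∈ (w 0).1, ∑ b ∈ (w 1).1 \ (w 0).1, ∑ c ∈ (w 2).1 \ (w 1).1,
      T.orient (w 2).1 a b c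
  | _, _ => 0

open Classical in
/-- The coefficients `c` in the expression `v = ∑ w, c v w • w` of a dual cell as a chain in the
refinement. The cells of dimension `q` that make up `⋆t` are the chains that start with `t`. -/
def chainCoeff (q : ℕ) (v : T.DualCell q) (w : T.FineCell q) : ℤ :=
  if (w 0).1 = v.1 then T.cellSign v.1 * T.dualSign q w else 0

/-- The number of cells of the refinement contained in a dual cell. -/
def dualCount (q : ℕ) (v : T.DualCell q) : ℤ := ∑ w : T.FineCell q, |T.chainCoeff q v w|

/-- The triangles of the refinement in the support of the basis form of `⋆t`, `dim t = r`: for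
`r = 0` those in the closed dual cell, for `r + 1` those in the supports for the dual cells
`⋆s` with `⋆t` in their boundary, i.e. with `s` in the boundary of `t`. -/
def supportTriangles : ℕ → Finset E → Set (T.FineCell 2)
  | 0, t => {z | (z 0).1 = t}
  | r + 1, t => ⋃ s ∈ {s : Finset E | s ∈ T.faces ∧ s.card = r + 1 ∧ s ⊆ t},
      supportTriangles r s

/-- The support of the basis form of the dual cell `v`, as a set of triangles. -/
def support {q : ℕ} (v : T.DualCell q) : Set (T.FineCell 2) := T.supportTriangles (2 - q) v.1

/-- The cell `w` is contained in the union of the closed triangles of `U`. -/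
def IsIn {q : ℕ} (w : T.FineCell q) (U : Set (T.FineCell 2)) : Prop :=
  ∃ z ∈ U, Set.range w ⊆ Set.range z

/-- The cell `w` is contained in the boundary of the union of the closed triangles of `U`. -/
def IsInBoundary {q : ℕ} (w : T.FineCell q) (U : Set (T.FineCell 2)) : Prop :=
  T.IsIn w U ∧ T.IsIn w Uᶜ

/-! ### Piecewise smooth forms and Whitney forms on the refinement -/

/-- The tangent plane of a triangle of the refinement. We use it as a chart of the plane of the
triangle, where `x` stands for the point `z.point 0 + x`. -/
abbrev tangent (z : T.FineCell 2) : Submodule ℝ E := vectorSpan ℝ (Set.range z.point)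

instance (z : T.FineCell 2) : FiniteDimensional ℝ (T.tangent z) :=
  finiteDimensional_vectorSpan_range ℝ _

/-- Piecewise smooth `q`-forms: a smooth form on (the plane of) each triangle of the refinement. -/
def Form (q : ℕ) : Type _ := ∀ z : T.FineCell 2, SmoothForm (T.tangent z) q

instance (q : ℕ) : AddCommGroup (T.Form q) :=
  inferInstanceAs (AddCommGroup (∀ z : T.FineCell 2, SmoothForm (T.tangent z) q))

instance (q : ℕ) : Module ℝ (T.Form q) :=
  inferInstanceAs (Module ℝ (∀ z : T.FineCell 2, SmoothForm (T.tangent z) q))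

/-- The exterior derivative, triangle by triangle. -/
def d (q : ℕ) : T.Form q →ₗ[ℝ] T.Form (q + 1) where
  toFun ω := fun z => SmoothForm.d (ω z)
  map_add' ω η := funext fun z => map_add SmoothForm.d (ω z) (η z)
  map_smul' c ω := funext fun z => map_smul SmoothForm.d c (ω z)

/-- The vertices of a triangle of the refinement in the chart of its plane. -/
def chartPoint (z : T.FineCell 2) (i : Fin 3) : T.tangent z :=
  ⟨z.point i - z.point 0, vsub_mem_vectorSpan ℝ ⟨i, rfl⟩ ⟨0, rfl⟩⟩

theorem affineIndependent_point {q : ℕ} (z : T.FineCell q) : AffineIndependent ℝ z.point := by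
  classical
  rw [affineIndependent_iff]
  intro s w hw hs
  set F : Finset E := (z (Fin.last q)).1 with hF
  have hsub : ∀ i, (z i).1 ⊆ F := fun i => (z.monotone (Fin.le_last i) : z i ≤ z (Fin.last q))
  have hne : ∀ i, (z i).1.Nonempty := fun i => T.nonempty_of_mem_faces (z i).2
  have hcard : ∀ i, ((z i).1.card : ℝ) ≠ 0 := fun i => by
    exact_mod_cast (Finset.card_pos.2 (hne i)).ne'
  have hpt : ∀ i, z.point i = ∑ v ∈ F, (if v ∈ (z i).1 then ((z i).1.card : ℝ)⁻¹ else 0) • v := by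
    intro i
    have h1 : ∑ v ∈ (z i).1, (z i).1.centroidWeights ℝ v = 1 :=
      Finset.sum_centroidWeights_eq_one_of_nonempty ℝ _ (hne i)
    rw [FineCell.point, Finset.centroid_def,
      Finset.affineCombination_eq_linear_combination _ _ _ h1]
    simp only [ite_smul, zero_smul, Finset.sum_ite_mem, Finset.inter_eq_right.2 (hsub i)]
    simp
  set u : E → ℝ := fun v => ∑ i ∈ s, w i * (if v ∈ (z i).1 then ((z i).1.card : ℝ)⁻¹ else 0)
    with hu
  have hind := T.indep (z (Fin.last q)).2
  rw [affineIndependent_iff] at hind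
  have h0 : ∑ v ∈ F, u v = 0 := by
    simp only [hu]
    rw [Finset.sum_comm]
    refine Eq.trans ?_ hw
    refine Finset.sum_congr rfl fun i _ => ?_
    rw [← Finset.mul_sum, Finset.sum_ite_mem, Finset.inter_eq_right.2 (hsub i)]
    simp [hcard i]
  have h1 : ∑ v ∈ F, u v • v = 0 := by
    simp only [hu, Finset.sum_smul]
    rw [Finset.sum_comm]
    refine Eq.trans ?_ hs
    refine Finset.sum_congr rfl fun i _ => ?_
    rw [hpt i, Finset.smul_sum]
    simp only [smul_smul]
  have hu0 : ∀ v ∈ F, u v = 0 := by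
    intro v hv
    refine hind Finset.univ (fun v => u v) ?_ ?_ ⟨v, hv⟩ (Finset.mem_univ _)
    · exact (Finset.sum_coe_sort F u).trans h0
    · exact (Finset.sum_coe_sort F fun v => u v • v).trans h1
  have key : ∀ i, ∃ v ∈ (z i).1, ∀ j < i, v ∉ (z j).1 := by
    intro i
    induction i using Fin.cases with
    | zero => exact ⟨_, (hne 0).choose_spec, fun j hj => absurd hj (Fin.not_lt_zero j)⟩
    | succ i =>
      have hlt : (z i.castSucc).1 < (z i.succ).1 := z.strictMono Fin.castSucc_lt_succ
      obtain ⟨v, hv, hv'⟩ := Finset.exists_of_ssubset hlt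
      refine ⟨v, hv, fun j hj hvj => hv' ?_⟩
      exact (z.monotone (Fin.le_castSucc_iff.2 hj) : z j ≤ z i.castSucc) hvj
  intro i
  induction i using WellFoundedGT.induction with
  | ind i ih =>
    intro hi
    obtain ⟨v, hv, hv'⟩ := key i
    have h2 := hu0 v (hsub i hv)
    simp only [hu] at h2
    rw [Finset.sum_eq_single_of_mem i hi, if_pos hv] at h2
    · exact (mul_eq_zero.1 h2).resolve_right (inv_ne_zero (hcard i))
    · intro j hj hji
      rcases lt_or_gt_of_ne hji with h | h
      · simp [hv' j h]
      · simp [ih j h hj]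

/-- The vertices of a triangle of the refinement as an affine basis of its plane. -/
def triangleBasis (z : T.FineCell 2) : AffineBasis (Fin 3) ℝ (T.tangent z) where
  toFun := T.chartPoint z
  ind' := by
    have h := T.affineIndependent_point z
    rw [affineIndependent_iff] at h ⊢
    intro s w hw hs
    refine h s w hw ?_
    have h2 := congrArg (T.tangent z).subtype hs
    simpa [chartPoint, smul_sub, Finset.sum_sub_distrib, ← Finset.sum_smul, hw] using h2
  tot' := by
    have h := T.affineIndependent_point z
    have hc : AffineIndependent ℝ (T.chartPoint z) := by
      rw [affineIndependent_iff] at h ⊢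
      intro s w hw hs
      refine h s w hw ?_
      have h2 := congrArg (T.tangent z).subtype hs
      simpa [chartPoint, smul_sub, Finset.sum_sub_distrib, ← Finset.sum_smul, hw] using h2
    rw [hc.affineSpan_eq_top_iff_card_eq_finrank_add_one]
    exact (h.finrank_vectorSpan_add_one).symm

open Classical in
/-- The barycentric coordinate function on the triangle `z` that belongs to the barycenter of `σ`;
it is zero if that is not a vertex of `z`. -/
def hat (z : T.FineCell 2) (σ : T.faces) : T.tangent z →ᵃ[ℝ] ℝ :=
  ∑ i, if z i = σ then (T.triangleBasis z).coord i else 0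

/-- The differential of `hat`, a constant `1`-form. -/
def dHat (z : T.FineCell 2) (σ : T.faces) : T.tangent z →L[ℝ] ℝ :=
  LinearMap.toContinuousLinearMap (T.hat z σ).linear

theorem contDiff_hat (z : T.FineCell 2) (σ : T.faces) :
    ContDiff ℝ ((⊤ : ℕ∞) : WithTop ℕ∞) fun x : T.tangent z => T.hat z σ x := by
  have h : (fun x : T.tangent z => T.hat z σ x) = fun x => T.dHat z σ x + T.hat z σ 0 :=
    (T.hat z σ).decomp
  rw [h]
  exact (T.dHat z σ).contDiff.add contDiff_const

/-- The standard basis form of the Whitney complex on the refinement that belongs to the cell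
`w = (w₀, …, w_q)`: on each triangle it is
`q! ∑ᵢ (-1)ⁱ λ_{wᵢ} dλ_{w₀} ∧ ⋯ (omit dλ_{wᵢ}) ⋯ ∧ dλ_{w_q}`, with `λ` the barycentric
coordinates. -/
def whitney (q : ℕ) (w : T.FineCell q) : T.Form q := fun z =>
  ⟨fun x => (q ! : ℝ) • ∑ i : Fin (q + 1), ((-1 : ℝ) ^ (i : ℕ) * T.hat z (w i) x) •
      wedge fun j : Fin q => T.dHat z (w (i.succAbove j)),
    (ContDiff.sum fun i _ => (contDiff_const.mul (T.contDiff_hat z (w i))).smul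
      contDiff_const).const_smul (q ! : ℝ)⟩

/-! ### The Buffa-Christiansen spaces -/

/-- The coefficients `R q v w` of the basis forms `μ v = ∑ w, R q v w • whitney q w`. -/
abbrev Coefficients : Type _ := ∀ q : ℕ, T.DualCell q → T.FineCell q → ℝ

/-- The requirements that determine the coefficients of the Buffa-Christiansen basis forms. -/
structure IsBuffaChristiansen (R : T.Coefficients) : Prop where
  /-- Local support, and zero trace on the boundary of the support. -/
  local_support : ∀ q (v : T.DualCell q) (w : T.FineCell q),
    ¬ T.IsIn w (T.support v) ∨ T.IsInBoundary w (T.support v) → R q v w = 0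
  /-- All cells of the refinement contained in the dual cell contribute with the same weight. -/
  same_weight : ∀ q (v : T.DualCell q) (w : T.FineCell q), T.chainCoeff q v w ≠ 0 →
    R q v w = (T.chainCoeff q v w : ℝ) / T.dualCount q v
  /-- Cells contained in the primal edge `t` do not contribute to the `1`-form of `⋆t`. -/
  stability : ∀ (v : T.DualCell 1) (w : T.FineCell 1), (w 1).1 ⊆ v.1 → R 1 v w = 0
  /-- The `1`-form of `⋆t` has exterior derivative `∑ s, D s t • μ (⋆s)` on the triangles in its
  support. -/
  recursion_one : ∀ (t : T.DualCell 1), ∀ z ∈ T.support t,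
    ∑ i : Fin 3, (-1 : ℝ) ^ (i : ℕ) * R 1 t (z.face i) =
      ∑ s : T.DualCell 2, (T.incidence s.1 t.1 : ℝ) * R 2 s z
  /-- The `0`-form of `⋆t` has exterior derivative `-∑ s, D s t • μ (⋆s)` along the edges
  contained in the primal triangle `t`. -/
  recursion_zero : ∀ (t : T.DualCell 0) (z : T.FineCell 1), (z 1).1 ⊆ t.1 →
    ∑ i : Fin 2, (-1 : ℝ) ^ (i : ℕ) * R 0 t (z.face i) =
      -∑ s : T.DualCell 1, (T.incidence s.1 t.1 : ℝ) * R 1 s z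

variable {T}

/-- The basis form of a dual cell, for given coefficients. -/
def basisForm (R : T.Coefficients) (q : ℕ) (v : T.DualCell q) : T.Form q :=
  ∑ w : T.FineCell q, R q v w • T.whitney q w

/-- The space spanned by the basis forms, for given coefficients. It is zero for `q > 2`. -/
def bcSpace (R : T.Coefficients) (q : ℕ) : Submodule ℝ (T.Form q) :=
  Submodule.span ℝ (Set.range (basisForm R q))

variable (T) in
/-- The images under `d` of the forms of degree `q - 1` in a family of spaces of forms. -/
def coboundaries (B : ∀ q, Submodule ℝ (T.Form q)) : (q : ℕ) → Submodule ℝ (T.Form q)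
  | 0 => ⊥
  | q + 1 => (B q).map (T.d q)

variable (T) in
/-- The dimension of the `q`-th cohomology of a family of spaces of forms under `d`. -/
def cohomologyDim (B : ∀ q, Submodule ℝ (T.Form q)) (q : ℕ) : ℕ :=
  Module.finrank ℝ (↥(B q ⊓ LinearMap.ker (T.d q)) ⧸
    (coboundaries T B q).submoduleOf (B q ⊓ LinearMap.ker (T.d q)))

end InterfaceMesh
end

noncomputable section

namespace InterfaceMesh

open scoped Classical

variable {E : Type*} [NormedAddCommGroup E] [NormedSpace ℝ E] {T : InterfaceMesh E}

/-! ### Cells of the mesh and of the refinement -/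

/-! Sending a mesh cell `t` of dimension `2 - q` to the form of `⋆t` identifies the space of
`q`-forms with the simplicial `(2 - q)`-chains and turns `d` into `±∂`. So the `q`-th cohomology is
the homology in degree `2 - q`, and Poincaré duality concludes. The work lies in showing that the
forms exist, are unique, and satisfy the derivative formulas everywhere.

Condition (1) says exactly that `R v w = 0` unless `w 0 ⊆ v` (`not_isIn_or_isInBoundary`), so (2)
fixes the `2`-forms. For an edge `t`, (2) prescribes `±1/2` on the two halves of `⋆t`; unknown are
the coefficients on the fine edges from an endpoint `p` of `t`. These spokes, with the fine
triangles between them, form a closed cycle, and (4) prescribes the differences of consecutive ones.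
Such a system is solvable if and only if the differences, signed by orientation, add up to zero
(`exists_link_potential`); the solution is unique up to a constant, which (3) fixes. The sum is zero
because all fine triangles in `⋆p` together contribute the same amount as the two halves of `⋆t`
(`exists_vertex_potential`). For a triangle `t`, (2) gives the value at the barycenter and (4)
integrates it along fine edges, consistently since `∂ ∘ ∂ = 0` (`incidence_comp`,
`edgeSum_cocycle`).

Condition (4) is only demanded near `⋆t`. For `1`-forms both sides vanish elsewhere. For `0`-forms
the defect of (4) is a cocycle that vanishes inside `t` and on every half of a dual edge, so it is
constant around each vertex, and zero (`vertexCoeff_recursion_everywhere`).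

The forms are independent, as only the form of `⋆t` has nonzero coefficients on the fine cells of
`⋆t`. Degree `1` then needs no duality, while degrees `0` and `2` need `betti 0 = betti 2`: the
closed `0`-cochains and the `2`-cycles are, up to orientation, the locally constant functions on
vertices and on triangles (`finrank_ker_coboundary`). -/

theorem card_le_three {s : Finset E} (hs : s ∈ T.faces) : s.card ≤ 3 := by
  obtain ⟨f, _, hf3, hsf⟩ := T.exists_facet s hs
  exact hf3 ▸ Finset.card_le_card hsf

theorem one_le_card {s : Finset E} (hs : s ∈ T.faces) : 1 ≤ s.card :=
  Finset.card_pos.2 (T.nonempty_of_mem_faces hs)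

theorem mem_faces_of_subset {s t : Finset E} (ht : t ∈ T.faces) (h : s ⊆ t) (hs : s.Nonempty) :
    s ∈ T.faces :=
  T.down_closed ht h hs

theorem num_ne {s : Finset E} (hs : s ∈ T.faces) {a b : E} (ha : a ∈ s) (hb : b ∈ s)
    (hab : a ≠ b) : T.num a ≠ T.num b := by
  intro h
  refine hab (T.num_injOn ?_ ?_ h)
  · exact mem_faces_of_subset hs (by simpa using ha) (by simp)
  · exact mem_faces_of_subset hs (by simpa using hb) (by simp)

/-- The cell of the refinement spanned by the barycenters of two nested cells. -/
def fineEdge (σ τ : T.faces) (h : σ < τ) : T.FineCell 1 :=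
  OrderEmbedding.ofStrictMono ![σ, τ] (by
    rw [Fin.strictMono_iff_lt_succ]
    intro i
    fin_cases i
    simpa using h)

/-- The cell of the refinement spanned by the barycenters of three nested cells. -/
def flag (ρ σ τ : T.faces) (h : ρ < σ) (h' : σ < τ) : T.FineCell 2 :=
  OrderEmbedding.ofStrictMono ![ρ, σ, τ] (by
    rw [Fin.strictMono_iff_lt_succ]
    intro i
    fin_cases i
    · simpa using h
    · simpa using h')

@[simp] theorem fineEdge_zero (σ τ : T.faces) (h : σ < τ) : fineEdge σ τ h 0 = σ := rfl
@[simp] theorem fineEdge_one (σ τ : T.faces) (h : σ < τ) : fineEdge σ τ h 1 = τ := rfl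
@[simp] theorem flag_zero (ρ σ τ : T.faces) (h : ρ < σ) (h' : σ < τ) :
    flag ρ σ τ h h' 0 = ρ := rfl
@[simp] theorem flag_one (ρ σ τ : T.faces) (h : ρ < σ) (h' : σ < τ) :
    flag ρ σ τ h h' 1 = σ := rfl
@[simp] theorem flag_two (ρ σ τ : T.faces) (h : ρ < σ) (h' : σ < τ) :
    flag ρ σ τ h h' 2 = τ := rfl

theorem fineVertex_ext {w w' : T.FineCell 0} (h : w 0 = w' 0) : w = w' :=
  DFunLike.ext _ _ fun i => by fin_cases i; exact h

theorem fineEdge_ext {w w' : T.FineCell 1} (h : w 0 = w' 0) (h' : w 1 = w' 1) : w = w' :=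
  DFunLike.ext _ _ fun i => by fin_cases i <;> assumption

theorem flag_ext {w w' : T.FineCell 2} (h : w 0 = w' 0) (h' : w 1 = w' 1) (h'' : w 2 = w' 2) :
    w = w' :=
  DFunLike.ext _ _ fun i => by fin_cases i <;> assumption

theorem FineCell.ssubset {q : ℕ} (w : T.FineCell q) {i j : Fin (q + 1)} (h : i < j) :
    (w i).1 ⊂ (w j).1 := by
  have := w.strictMono h
  exact this

theorem FineCell.subset {q : ℕ} (w : T.FineCell q) {i j : Fin (q + 1)} (h : i ≤ j) :
    (w i).1 ⊆ (w j).1 :=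
  w.monotone h

theorem FineCell.card_lt {q : ℕ} (w : T.FineCell q) {i j : Fin (q + 1)} (h : i < j) :
    (w i).1.card < (w j).1.card :=
  Finset.card_lt_card (w.ssubset h)

theorem flag_card (z : T.FineCell 2) :
    (z 0).1.card = 1 ∧ (z 1).1.card = 2 ∧ (z 2).1.card = 3 := by
  have h1 := one_le_card (z 0).2
  have h2 := card_le_three (z 2).2
  have h3 := z.card_lt (show (0 : Fin 3) < 1 by decide)
  have h4 := z.card_lt (show (1 : Fin 3) < 2 by decide)
  omega

/-- Cardinalities grow strictly along a chain, from at least `1` to at most `3`. This disposes of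
the entries of `Coefficients` in degrees `3 ≤ q`. -/
theorem isEmpty_fineCell {q : ℕ} (hq : 3 ≤ q) : IsEmpty (T.FineCell q) := by
  refine ⟨fun w => ?_⟩
  have key : ∀ n (hn : n < q + 1), n + 1 ≤ (w ⟨n, hn⟩).1.card := by
    intro n
    induction n with
    | zero => exact fun hn => one_le_card (w ⟨0, hn⟩).2
    | succ n ih =>
      intro hn
      have h1 := ih (by omega)
      have h2 := w.card_lt (show (⟨n, by omega⟩ : Fin (q + 1)) < ⟨n + 1, hn⟩ by simp)
      omega
  have h1 := key 3 (by omega)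
  have h2 := card_le_three (w ⟨3, by omega⟩).2
  omega

/-- The vertices of a triangle of the mesh, in the order prescribed by a flag. -/
theorem exists_points (z : T.FineCell 2) : ∃ a b c : E, a ≠ b ∧ a ≠ c ∧ b ≠ c ∧
    (z 0).1 = {a} ∧ (z 1).1 = {a, b} ∧ (z 2).1 = {a, b, c} := by
  obtain ⟨h0, h1, h2⟩ := flag_card z
  have h01 := z.subset (show (0 : Fin 3) ≤ 1 by decide)
  have h12 := z.subset (show (1 : Fin 3) ≤ 2 by decide)
  obtain ⟨a, ha⟩ := Finset.card_eq_one.1 h0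
  have e1 : ((z 1).1 \ (z 0).1).card = 1 := by
    rw [Finset.card_sdiff_of_subset h01]; omega
  have e2 : ((z 2).1 \ (z 1).1).card = 1 := by
    rw [Finset.card_sdiff_of_subset h12]; omega
  obtain ⟨b, hb⟩ := Finset.card_eq_one.1 e1
  obtain ⟨c, hc⟩ := Finset.card_eq_one.1 e2
  have hb' : b ∈ (z 1).1 \ (z 0).1 := by simp [hb]
  have hc' : c ∈ (z 2).1 \ (z 1).1 := by simp [hc]
  rw [Finset.mem_sdiff] at hb' hc'
  have z1 : (z 1).1 = {a, b} := by
    rw [← Finset.union_sdiff_of_subset h01, hb, ha]; rfl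
  have z2 : (z 2).1 = {a, b, c} := by
    rw [← Finset.union_sdiff_of_subset h12, hc, z1]; ext; simp
  rw [ha] at hb'
  rw [z1] at hc'
  simp only [Finset.mem_insert, Finset.mem_singleton, not_or] at hb' hc'
  exact ⟨a, b, c, Ne.symm hb'.2, Ne.symm hc'.2.1, Ne.symm hc'.2.2, ha, z1, z2⟩

/-- A flag is determined by its ordered vertices. -/
theorem exists_flag_of_points {a b c : E} (hab : a ≠ b) (hac : a ≠ c) (hbc : b ≠ c)
    (hf : ({a, b, c} : Finset E) ∈ T.faces) :
    ∃ z : T.FineCell 2, (z 0).1 = {a} ∧ (z 1).1 = {a, b} ∧ (z 2).1 = {a, b, c} := by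
  have h1 : ({a} : Finset E) ∈ T.faces := mem_faces_of_subset hf (by simp) (by simp)
  have h2 : ({a, b} : Finset E) ∈ T.faces :=
    mem_faces_of_subset hf (by intro x; simp; tauto) (by simp)
  refine ⟨flag ⟨_, h1⟩ ⟨_, h2⟩ ⟨_, hf⟩ ?_ ?_, rfl, rfl, rfl⟩
  · refine Finset.ssubset_iff_subset_ne.2 ⟨by simp, fun h => hab ?_⟩
    have : b ∈ ({a} : Finset E) := by
      change ({a} : Finset E) = {a, b} at h
      simp [h]
    simpa using (Finset.mem_singleton.1 this).symm
  · refine Finset.ssubset_iff_subset_ne.2 ⟨by intro x; simp; tauto, fun h => ?_⟩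
    have : c ∈ ({a, b} : Finset E) := by
      change ({a, b} : Finset E) = {a, b, c} at h
      simp [h]
    simp only [Finset.mem_insert, Finset.mem_singleton] at this
    tauto

theorem exists_flag_of_facet {p : E} {f : Finset E} (hf : f ∈ T.faces) (hf3 : f.card = 3)
    (hp : p ∈ f) : ∃ z : T.FineCell 2, (z 0).1 = {p} ∧ (z 2).1 = f := by
  have h : (f.erase p).card = 2 := by rw [Finset.card_erase_of_mem hp]; omega
  obtain ⟨b, c, hbc, h⟩ := Finset.card_eq_two.1 h
  have hf' : f = {p, b, c} := by rw [← Finset.insert_erase hp, h]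
  have hb : b ∈ f.erase p := by simp [h]
  have hc : c ∈ f.erase p := by simp [h]
  obtain ⟨z, h0, -, h2⟩ := exists_flag_of_points (T := T) (Finset.ne_of_mem_erase hb).symm
    (Finset.ne_of_mem_erase hc).symm hbc (hf' ▸ hf)
  exact ⟨z, h0, h2.trans hf'.symm⟩

theorem exists_flag_of_edge_facet {p : E} {e f : Finset E} (hf : f ∈ T.faces) (hf3 : f.card = 3)
    (he : e.card = 2) (hef : e ⊆ f) (hp : p ∈ e) :
    ∃ z : T.FineCell 2, (z 0).1 = {p} ∧ (z 1).1 = e ∧ (z 2).1 = f := by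
  have h : (e.erase p).card = 1 := by rw [Finset.card_erase_of_mem hp]; omega
  obtain ⟨b, hb⟩ := Finset.card_eq_one.1 h
  have he' : e = {p, b} := by rw [← Finset.insert_erase hp, hb]
  have hb' : b ∈ e.erase p := by simp [hb]
  have h : (f \ e).card = 1 := by rw [Finset.card_sdiff_of_subset hef]; omega
  obtain ⟨c, hc⟩ := Finset.card_eq_one.1 h
  have hc' : c ∈ f \ e := by simp [hc]
  have hf' : f = {p, b, c} := by
    rw [← Finset.union_sdiff_of_subset hef, hc, he']; ext; simp
  rw [Finset.mem_sdiff, he'] at hc'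
  simp only [Finset.mem_insert, Finset.mem_singleton, not_or] at hc'
  obtain ⟨z, h0, h1, h2⟩ := exists_flag_of_points (T := T) (Finset.ne_of_mem_erase hb').symm
    (Ne.symm hc'.2.1) (Ne.symm hc'.2.2) (hf' ▸ hf)
  exact ⟨z, h0, h1.trans he'.symm, h2.trans hf'.symm⟩

/-- If one of the cells is an edge, it is the middle of the flag. Otherwise each is `{p}` or the
surrounding triangle `f`, and any flag from `p` in `f` works. -/
theorem exists_flag_of_le {p : E} {σ τ : T.faces} (h : σ ≤ τ) (hp : p ∈ σ.1) :
    ∃ z : T.FineCell 2, (z 0).1 = {p} ∧ σ ∈ Set.range z ∧ τ ∈ Set.range z := by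
  obtain ⟨f, hf, hf3, hτf⟩ := T.exists_facet τ.1 τ.2
  have hστ : σ.1 ⊆ τ.1 := h
  have hc := Finset.card_le_card hστ
  have h1 := one_le_card σ.2
  have h3 := card_le_three τ.2
  have hs : σ.1.card = 1 → σ.1 = {p} := fun h => by
    obtain ⟨a, ha⟩ := Finset.card_eq_one.1 h
    rw [ha] at hp ⊢
    rw [Finset.mem_singleton.1 hp]
  have heq : σ.1.card = τ.1.card → σ = τ := fun h =>
    Subtype.ext (Finset.eq_of_subset_of_card_le hστ h.ge)
  have hfe : τ.1.card = 3 → f = τ.1 := fun h =>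
    (Finset.eq_of_subset_of_card_le hτf (by omega)).symm
  by_cases c : σ.1.card = 2 ∨ τ.1.card = 2
  · obtain ⟨e, he, hpe, hef, hσ, hτ⟩ : ∃ e : Finset E, e.card = 2 ∧ p ∈ e ∧ e ⊆ f ∧
        (σ.1 = {p} ∨ σ.1 = e ∨ σ.1 = f) ∧ (τ.1 = {p} ∨ τ.1 = e ∨ τ.1 = f) := by
      by_cases cσ : σ.1.card = 2
      · refine ⟨σ.1, cσ, hp, hστ.trans hτf, Or.inr (Or.inl rfl), Or.inr ?_⟩
        by_cases cτ : τ.1.card = 2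
        · rw [heq (by omega)]; exact Or.inl rfl
        · exact Or.inr (hfe (by omega)).symm
      · exact ⟨τ.1, by omega, hστ hp, hτf, Or.inl (hs (by omega)), Or.inr (Or.inl rfl)⟩
    obtain ⟨z, h0, h1, h2⟩ := exists_flag_of_edge_facet hf hf3 he hef hpe
    rw [← h0, ← h1, ← h2] at hσ hτ
    refine ⟨z, h0, ?_, ?_⟩
    · rcases hσ with h | h | h <;> exact ⟨_, Subtype.ext h.symm⟩
    · rcases hτ with h | h | h <;> exact ⟨_, Subtype.ext h.symm⟩
  · obtain ⟨z, h0, h2⟩ := exists_flag_of_facet hf hf3 (hτf (hστ hp))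
    have aux : ∀ ρ : T.faces, ρ.1 = {p} ∨ ρ.1 = f → ρ ∈ Set.range z := by
      rintro ρ (h | h)
      · exact ⟨0, Subtype.ext (h0.trans h.symm)⟩
      · exact ⟨2, Subtype.ext (h2.trans h.symm)⟩
    refine ⟨z, h0, aux σ ?_, aux τ ?_⟩
    · by_cases cσ : σ.1.card = 1
      · exact Or.inl (hs cσ)
      · rw [heq (by omega)]; exact Or.inr (hfe (by omega)).symm
    · by_cases cτ : τ.1.card = 1
      · rw [← heq (by omega)]; exact Or.inl (hs (by omega))
      · exact Or.inr (hfe (by omega)).symm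

/-- The free choice of the starting vertex matters: a vertex of `w 0` outside `t` yields a triangle
at `w` outside the support for `⋆t`. -/
theorem exists_flag {q : ℕ} (w : T.FineCell q) {p : E} (hp : p ∈ (w 0).1) :
    ∃ z : T.FineCell 2, (z 0).1 = {p} ∧ Set.range w ⊆ Set.range z := by
  match q, w with
  | 0, w =>
    obtain ⟨z, h0, h1, -⟩ := exists_flag_of_le (le_refl (w 0)) hp
    refine ⟨z, h0, ?_⟩
    rintro _ ⟨i, rfl⟩
    fin_cases i
    exact h1
  | 1, w =>
    obtain ⟨z, h0, h1, h2⟩ := exists_flag_of_le (w.monotone (show (0 : Fin 2) ≤ 1 by decide)) hp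
    refine ⟨z, h0, ?_⟩
    rintro _ ⟨i, rfl⟩
    fin_cases i
    · exact h1
    · exact h2
  | 2, w =>
    refine ⟨w, ?_, le_rfl⟩
    obtain ⟨a, ha⟩ := Finset.card_eq_one.1 (flag_card w).1
    rw [ha] at hp ⊢
    rw [Finset.mem_singleton.1 hp]
  | q + 3, w => exact ((isEmpty_fineCell (by omega)).false w).elim

/-- Two triangles meet in an edge, and only two. -/
theorem exists_two_facets {e : Finset E} (he : e ∈ T.faces) (he2 : e.card = 2) :
    ∃ f g : Finset E, f ≠ g ∧ ∀ h, (h ∈ T.faces ∧ h.card = 3 ∧ e ⊆ h) ↔ h = f ∨ h = g := by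
  obtain ⟨f, g, hfg, h⟩ := Set.ncard_eq_two.1 (T.edge_two_facets e he he2)
  refine ⟨f, g, hfg, fun x => ?_⟩
  exact Set.ext_iff.1 h x

/-- The two triangles of the refinement at a vertex of the mesh that contain a given edge. -/
theorem exists_two_flags_edge {p : E} {e : Finset E} (he : e ∈ T.faces) (he2 : e.card = 2)
    (hp : p ∈ e) : ∃ z z' : T.FineCell 2, z ≠ z' ∧
      ∀ x : T.FineCell 2, (x 0).1 = {p} ∧ (x 1).1 = e ↔ x = z ∨ x = z' := by
  obtain ⟨f, g, hfg, h⟩ := exists_two_facets he he2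
  obtain ⟨hf, hf3, hef⟩ := (h f).2 (Or.inl rfl)
  obtain ⟨hg, hg3, heg⟩ := (h g).2 (Or.inr rfl)
  obtain ⟨z, h0, h1, h2⟩ := exists_flag_of_edge_facet hf hf3 he2 hef hp
  obtain ⟨z', h0', h1', h2'⟩ := exists_flag_of_edge_facet hg hg3 he2 heg hp
  refine ⟨z, z', fun hz => hfg (by rw [← h2, ← h2', hz]), fun x => ⟨fun hx => ?_, ?_⟩⟩
  · have := (h (x 2).1).1
      ⟨(x 2).2, (flag_card x).2.2, hx.2 ▸ x.subset (show (1 : Fin 3) ≤ 2 by decide)⟩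
    rcases this with h | h
    · exact Or.inl (flag_ext (Subtype.ext (hx.1.trans h0.symm))
        (Subtype.ext (hx.2.trans h1.symm)) (Subtype.ext (h.trans h2.symm)))
    · exact Or.inr (flag_ext (Subtype.ext (hx.1.trans h0'.symm))
        (Subtype.ext (hx.2.trans h1'.symm)) (Subtype.ext (h.trans h2'.symm)))
  · rintro (rfl | rfl)
    · exact ⟨h0, h1⟩
    · exact ⟨h0', h1'⟩

/-- The two triangles of the refinement at a vertex of the mesh in a given triangle. -/
theorem exists_two_flags_facet {p : E} {f : Finset E} (hf : f ∈ T.faces) (hf3 : f.card = 3)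
    (hp : p ∈ f) : ∃ z z' : T.FineCell 2, z ≠ z' ∧
      ∀ x : T.FineCell 2, (x 0).1 = {p} ∧ (x 2).1 = f ↔ x = z ∨ x = z' := by
  have h : (f.erase p).card = 2 := by rw [Finset.card_erase_of_mem hp]; omega
  obtain ⟨b, c, hbc, h⟩ := Finset.card_eq_two.1 h
  have hf' : f = {p, b, c} := by rw [← Finset.insert_erase hp, h]
  have hb : b ∈ f.erase p := by simp [h]
  have hc : c ∈ f.erase p := by simp [h]
  have hpb := (Finset.ne_of_mem_erase hb).symm
  have hpc := (Finset.ne_of_mem_erase hc).symm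
  obtain ⟨z, h0, h1, h2⟩ := exists_flag_of_points (T := T) hpb hpc hbc (hf' ▸ hf)
  have hf'' : ({p, c, b} : Finset E) = f := by rw [hf', Finset.pair_comm]
  obtain ⟨z', h0', h1', h2'⟩ := exists_flag_of_points (T := T) hpc hpb hbc.symm (hf'' ▸ hf)
  refine ⟨z, z', fun hz => ?_, fun x => ⟨fun hx => ?_, ?_⟩⟩
  · rw [hz, h1'] at h1
    have : c ∈ ({p, b} : Finset E) := by simp [← h1]
    simp only [Finset.mem_insert, Finset.mem_singleton] at this
    rcases this with h | h
    · exact hpc h.symm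
    · exact hbc h.symm
  · obtain ⟨a, b', c', hab, hac, hbc', x0, x1, x2⟩ := exists_points x
    have ha : a = p := by
      have := x0.symm.trans hx.1
      simpa using this
    subst ha
    have hb' : b' ∈ f := by rw [← hx.2, x2]; simp
    rw [hf'] at hb'
    simp only [Finset.mem_insert, Finset.mem_singleton] at hb'
    rcases hb' with h | rfl | rfl
    · exact absurd h.symm hab
    · exact Or.inl (flag_ext (Subtype.ext (hx.1.trans h0.symm))
        (Subtype.ext (x1.trans h1.symm)) (Subtype.ext (hx.2.trans (hf'.trans h2.symm))))
    · exact Or.inr (flag_ext (Subtype.ext (hx.1.trans h0'.symm))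
        (Subtype.ext (x1.trans h1'.symm)) (Subtype.ext (hx.2.trans (hf''.symm.trans h2'.symm))))
  · rintro (rfl | rfl)
    · exact ⟨h0, h2.trans hf'.symm⟩
    · exact ⟨h0', h2'.trans hf''⟩

/-- The two cells of the refinement that make up the dual cell of an edge. -/
theorem exists_two_fineEdges {e : Finset E} (he : e ∈ T.faces) (he2 : e.card = 2) :
    ∃ w w' : T.FineCell 1, w ≠ w' ∧ ∀ x : T.FineCell 1, (x 0).1 = e ↔ x = w ∨ x = w' := by
  obtain ⟨f, g, hfg, h⟩ := exists_two_facets he he2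
  obtain ⟨hf, hf3, hef⟩ := (h f).2 (Or.inl rfl)
  obtain ⟨hg, hg3, heg⟩ := (h g).2 (Or.inr rfl)
  have hlt : ∀ {k : Finset E} (hk : k ∈ T.faces), k.card = 3 → e ⊆ k →
      (⟨e, he⟩ : T.faces) < ⟨k, hk⟩ := fun hk h3 hek =>
    Finset.ssubset_iff_subset_ne.2 ⟨hek, fun h => by
      have := congrArg Finset.card h
      simp only at this
      omega⟩
  refine ⟨fineEdge _ _ (hlt hf hf3 hef), fineEdge _ _ (hlt hg hg3 heg), fun hz => hfg ?_,
    fun x => ⟨fun hx => ?_, ?_⟩⟩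
  · exact congrArg (fun w : T.FineCell 1 => (w 1).1) hz
  · have hc := x.card_lt (show (0 : Fin 2) < 1 by decide)
    have := (h (x 1).1).1 ⟨(x 1).2, by have := card_le_three (x 1).2; rw [hx] at hc; omega,
      hx ▸ x.subset (show (0 : Fin 2) ≤ 1 by decide)⟩
    rcases this with h | h
    · exact Or.inl (fineEdge_ext (Subtype.ext hx) (Subtype.ext h))
    · exact Or.inr (fineEdge_ext (Subtype.ext hx) (Subtype.ext h))
  · rintro (rfl | rfl) <;> rfl

/-! ### Signs -/

theorem sign_sub_comm (m n : ℤ) : (m - n).sign = -(n - m).sign := by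
  rw [← Int.sign_neg, neg_sub]

theorem sign_sub_mul_self {m n : ℕ} (h : m ≠ n) :
    ((m : ℤ) - n).sign * ((m : ℤ) - n).sign = 1 := by
  rw [← Int.sign_mul, Int.sign_eq_one_of_pos]
  have : (m : ℤ) - n ≠ 0 := sub_ne_zero.2 (by exact_mod_cast h)
  exact mul_self_pos.2 this

theorem coe_unit_mul_self (u : ℤˣ) : (u : ℤ) * u = 1 := by
  rw [← Units.val_mul, Int.units_mul_self, Units.val_one]

theorem sign_of_lt {m n : ℕ} (h : m < n) : ((n : ℤ) - m).sign = 1 :=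
  Int.sign_eq_one_of_pos (by omega)

theorem sign_of_gt {m n : ℕ} (h : n < m) : ((n : ℤ) - m).sign = -1 :=
  Int.sign_eq_neg_one_of_neg (by omega)

theorem insert_singleton_sdiff_singleton {X : Type*} {a b : X} (hab : a ≠ b) :
    ({a, b} : Finset X) \ {a} = {b} := by
  ext x
  simp only [Finset.mem_sdiff, Finset.mem_insert, Finset.mem_singleton]
  constructor
  · tauto
  · rintro rfl; exact ⟨Or.inr rfl, hab.symm⟩

theorem triple_sdiff_pair {X : Type*} {a b c : X} (hac : a ≠ c) (hbc : b ≠ c) :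
    ({a, b, c} : Finset X) \ {a, b} = {c} := by
  ext x
  simp only [Finset.mem_sdiff, Finset.mem_insert, Finset.mem_singleton]
  constructor
  · tauto
  · rintro rfl; exact ⟨Or.inr (Or.inr rfl), by tauto⟩

theorem dualSign_two {z : T.FineCell 2} {a b c : E} (hab : a ≠ b) (hac : a ≠ c) (hbc : b ≠ c)
    (h0 : (z 0).1 = {a}) (h1 : (z 1).1 = {a, b}) (h2 : (z 2).1 = {a, b, c}) :
    T.dualSign 2 z = T.surfaceSign (z 2).1 * sortSign T.num a b c := by
  rw [dualSign, h0, h1, h2, insert_singleton_sdiff_singleton hab, triple_sdiff_pair hac hbc]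
  simp [orient]

/-- The right-hand side is symmetric in `a` and `b`, so the ordering by `num` in the definition
disappears. -/
theorem dualSign_one {w : T.FineCell 1} {a b c : E} (hab : a ≠ b) (hac : a ≠ c) (hbc : b ≠ c)
    (h0 : (w 0).1 = {a, b}) (h1 : (w 1).1 = {a, b, c}) :
    T.dualSign 1 w = -(T.surfaceSign (w 1).1 * (((T.num c : ℤ) - T.num a).sign *
      ((T.num c : ℤ) - T.num b).sign)) := by
  have hn : T.num a ≠ T.num b := num_ne (w 0).2 (by simp [h0]) (by simp [h0]) hab
  rw [dualSign, h0, h1, triple_sdiff_pair hac hbc]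
  simp only [Finset.sum_singleton, Finset.filter_insert, Finset.filter_singleton]
  rw [Finset.sum_pair hab]
  rcases lt_or_gt_of_ne hn with h | h
  · have h' := sign_of_lt h
    simp only [lt_irrefl, if_false, h, if_true, h.not_gt, Finset.sum_singleton, Finset.sum_empty]
    simp only [orient, sortSign, h', sign_sub_comm (T.num b) (T.num c)]
    ring
  · have h' := sign_of_lt h
    simp only [lt_irrefl, if_false, h, if_true, h.not_gt, Finset.sum_singleton, Finset.sum_empty,
      insert_empty_eq]
    simp only [orient, sortSign, h', sign_sub_comm (T.num a) (T.num c)]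
    ring

theorem incidence_vertex {a b : E} (hab : a ≠ b) (hf : ({a, b} : Finset E) ∈ T.faces) :
    T.incidence {a} {a, b} =
      T.cellSign {a} * T.cellSign {a, b} * ((T.num a : ℤ) - T.num b).sign := by
  have hn : T.num a ≠ T.num b := num_ne hf (by simp) (by simp) hab
  have e1 : ({a, b} : Finset E).erase a = {b} := by ext; simp; grind
  have e2 : ({a, b} : Finset E).erase b = {a} := by ext; simp; grind
  rw [incidence]
  congr 1
  rw [Finset.sum_pair hab, e1, e2, if_neg (by simpa using hab.symm), if_pos rfl]
  simp only [Finset.filter_insert, Finset.filter_singleton]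
  rcases lt_or_gt_of_ne hn with h | h
  · simp [h, sign_of_gt h]
  · simp [h.not_gt, sign_of_lt h]

/-- The position of `c` counts which of `a`, `b` have smaller numbers. Of two vertices, this count
has the same parity as that of the larger ones, which the product of signs detects. -/
theorem incidence_edge {a b c : E} (hab : a ≠ b) (hac : a ≠ c) (hbc : b ≠ c)
    (hf : ({a, b, c} : Finset E) ∈ T.faces) :
    T.incidence {a, b} {a, b, c} = T.cellSign {a, b} * T.cellSign {a, b, c} *
      (((T.num c : ℤ) - T.num a).sign * ((T.num c : ℤ) - T.num b).sign) := by
  have hna : T.num a ≠ T.num c := num_ne hf (by simp) (by simp) hac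
  have hnb : T.num b ≠ T.num c := num_ne hf (by simp) (by simp) hbc
  rw [incidence]
  congr 1
  rw [Finset.sum_eq_single_of_mem c (by simp), if_pos (by ext; simp; grind)]
  · have : ({a, b, c} : Finset E).filter (fun u => T.num u < T.num c) =
        ({a, b} : Finset E).filter (fun u => T.num u < T.num c) := by ext; simp; grind
    rw [this, Finset.filter_insert, Finset.filter_singleton]
    rcases lt_or_gt_of_ne hna with h | h <;> rcases lt_or_gt_of_ne hnb with h' | h'
    · simp [h, h', sign_of_lt h, sign_of_lt h', hab]
    · simp [h, h'.not_gt, sign_of_lt h, sign_of_gt h']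
    · simp [h.not_gt, h', sign_of_gt h, sign_of_lt h']
    · simp [h.not_gt, h'.not_gt, sign_of_gt h, sign_of_gt h']
  · intro v _ hv
    refine if_neg fun h => ?_
    have : c ∈ ({a, b} : Finset E) := by
      rw [← h]
      simp [hv.symm]
    simp only [Finset.mem_insert, Finset.mem_singleton] at this
    tauto

theorem incidence_eq_zero {s t : Finset E} (h : ¬ s ⊆ t) : T.incidence s t = 0 := by
  rw [incidence, Finset.sum_eq_zero, mul_zero]
  intro v _
  refine if_neg fun h' => h ?_
  rw [← h']
  exact Finset.erase_subset _ _

/-- The vertices of an edge and its opposite vertex in a triangle. -/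
theorem exists_points_edge (w : T.FineCell 1) (hw : (w 0).1.card = 2) : ∃ a b c : E,
    a ≠ b ∧ a ≠ c ∧ b ≠ c ∧ (w 0).1 = {a, b} ∧ (w 1).1 = {a, b, c} := by
  obtain ⟨a, b, hab, h⟩ := Finset.card_eq_two.1 hw
  obtain ⟨z, h0, hz⟩ := exists_flag w (p := a) (by simp [h])
  have hc := w.card_lt (show (0 : Fin 2) < 1 by decide)
  have hc3 := card_le_three (w 1).2
  have hzc := flag_card z
  have key : ∀ i, ∃ j, w i = z j := fun i => by
    obtain ⟨j, hj⟩ := hz ⟨i, rfl⟩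
    exact ⟨j, hj.symm⟩
  have h1 : w 0 = z 1 := by
    obtain ⟨j, hj⟩ := key 0
    rw [hj] at hw ⊢
    fin_cases j <;> simp_all
  have h2 : w 1 = z 2 := by
    obtain ⟨j, hj⟩ := key 1
    rw [hj] at hc ⊢
    fin_cases j <;> simp_all
  obtain ⟨a', b', c', h⟩ := exists_points z
  exact ⟨a', b', c', h.1, h.2.1, h.2.2.1, h1 ▸ h.2.2.2.2.1, h2 ▸ h.2.2.2.2.2⟩

theorem dualSign_two_mul_self (z : T.FineCell 2) : T.dualSign 2 z * T.dualSign 2 z = 1 := by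
  obtain ⟨a, b, c, hab, hac, hbc, h0, h1, h2⟩ := exists_points z
  have hna : T.num b ≠ T.num a := num_ne (z 2).2 (by simp [h2]) (by simp [h2]) hab.symm
  have hnb : T.num c ≠ T.num a := num_ne (z 2).2 (by simp [h2]) (by simp [h2]) hac.symm
  have hnc : T.num c ≠ T.num b := num_ne (z 2).2 (by simp [h2]) (by simp [h2]) hbc.symm
  rw [dualSign_two hab hac hbc h0 h1 h2, sortSign]
  linear_combination (sign_sub_mul_self hna * (((T.num c : ℤ) - T.num a).sign ^ 2 *
    ((T.num c : ℤ) - T.num b).sign ^ 2) + sign_sub_mul_self hnb * ((T.num c : ℤ) - T.num b).sign ^ 2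
    + sign_sub_mul_self hnc) + coe_unit_mul_self (T.surfaceSign (z 2).1) *
    (((T.num b : ℤ) - T.num a).sign * ((T.num c : ℤ) - T.num a).sign *
    ((T.num c : ℤ) - T.num b).sign) ^ 2

theorem dualSign_one_mul_self (w : T.FineCell 1) (hw : (w 0).1.card = 2) :
    T.dualSign 1 w * T.dualSign 1 w = 1 := by
  obtain ⟨a, b, c, hab, hac, hbc, h0, h1⟩ := exists_points_edge w hw
  have hnb : T.num c ≠ T.num a := num_ne (w 1).2 (by simp [h1]) (by simp [h1]) hac.symm
  have hnc : T.num c ≠ T.num b := num_ne (w 1).2 (by simp [h1]) (by simp [h1]) hbc.symm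
  rw [dualSign_one hab hac hbc h0 h1]
  linear_combination sign_sub_mul_self hnb * ((T.num c : ℤ) - T.num b).sign ^ 2
    + sign_sub_mul_self hnc + coe_unit_mul_self (T.surfaceSign (w 1).1) *
    (((T.num c : ℤ) - T.num a).sign * ((T.num c : ℤ) - T.num b).sign) ^ 2

/-- The incidence number of an edge and a triangle. -/
theorem incidence_eq_neg_dualSign (w : T.FineCell 1) (hw : (w 0).1.card = 2) :
    T.incidence (w 0).1 (w 1).1 = -((T.cellSign (w 0).1 * T.dualSign 1 w) *
      (T.cellSign (w 1).1 * T.surfaceSign (w 1).1)) := by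
  obtain ⟨a, b, c, hab, hac, hbc, h0, h1⟩ := exists_points_edge w hw
  rw [dualSign_one hab hac hbc h0 h1, h0, h1, incidence_edge hab hac hbc (h1 ▸ (w 1).2)]
  linear_combination -coe_unit_mul_self (T.surfaceSign {a, b, c}) *
    T.cellSign {a, b} * T.cellSign {a, b, c} *
      (((T.num c : ℤ) - T.num a).sign * ((T.num c : ℤ) - T.num b).sign)

/-- The boundary of a dual face consists of dual edges. -/
theorem incidence_mul_cellSign (z : T.FineCell 2) :
    T.incidence (z 0).1 (z 1).1 * T.cellSign (z 0).1 =
      T.dualSign 2 z * (T.cellSign (z 1).1 * T.dualSign 1 (z.face 0)) := by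
  obtain ⟨a, b, c, hab, hac, hbc, h0, h1, h2⟩ := exists_points z
  have hnb : T.num c ≠ T.num a := num_ne (z 2).2 (by simp [h2]) (by simp [h2]) hac.symm
  have hnc : T.num c ≠ T.num b := num_ne (z 2).2 (by simp [h2]) (by simp [h2]) hbc.symm
  have hf : ∀ h : z.face 0 1 = z 2, T.dualSign 1 (z.face 0) =
      -(T.surfaceSign (z 2).1 * (((T.num c : ℤ) - T.num a).sign *
      ((T.num c : ℤ) - T.num b).sign)) := fun h => by
    rw [dualSign_one (w := z.face 0) hab hac hbc h1 h2, h]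
  rw [dualSign_two hab hac hbc h0 h1 h2, hf rfl, h0, h1, h2,
    incidence_vertex hab (h1 ▸ (z 1).2), sortSign, sign_sub_comm (T.num a) (T.num b)]
  linear_combination (exp := 1)
    (-(T.cellSign {a, b} : ℤ) * ((T.num b : ℤ) - T.num a).sign) *
      coe_unit_mul_self (T.cellSign {a}) +
    (T.cellSign {a, b} : ℤ) * ((T.num b : ℤ) - T.num a).sign * (
      coe_unit_mul_self (T.surfaceSign {a, b, c}) *
      (((T.num c : ℤ) - T.num a).sign * ((T.num c : ℤ) - T.num b).sign) ^ 2 +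
      sign_sub_mul_self hnb * ((T.num c : ℤ) - T.num b).sign ^ 2 + sign_sub_mul_self hnc)

/-- The two halves of a dual edge have opposite orientation. -/
theorem dualSign_one_eq_neg {w w' : T.FineCell 1} (hw : (w 0).1.card = 2) (h : w 0 = w' 0)
    (hne : w ≠ w') : T.dualSign 1 w = -T.dualSign 1 w' := by
  obtain ⟨a, b, c, hab, hac, hbc, h0, h1⟩ := exists_points_edge w hw
  have hcw' := w'.card_lt (show (0 : Fin 2) < 1 by decide)
  have hcw3 := card_le_three (w' 1).2
  have hs := w'.subset (show (0 : Fin 2) ≤ 1 by decide)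
  have e2 : ((w' 1).1 \ (w' 0).1).card = 1 := by
    rw [Finset.card_sdiff_of_subset hs]; rw [h] at hw; omega
  obtain ⟨d, hd⟩ := Finset.card_eq_one.1 e2
  have hd' : d ∈ (w' 1).1 \ (w' 0).1 := by simp [hd]
  have h1' : (w' 1).1 = {a, b, d} := by
    rw [← Finset.union_sdiff_of_subset hs, hd, ← h, h0]; ext; simp
  rw [Finset.mem_sdiff, ← h, h0] at hd'
  simp only [Finset.mem_insert, Finset.mem_singleton, not_or] at hd'
  have hcd : c ≠ d := by
    rintro rfl
    exact hne (fineEdge_ext h (Subtype.ext (h1.trans h1'.symm)))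
  have hc1 : (w 1).1.card = 3 := by
    rw [h1]; simp [hab, hac, hbc]
  have hc1' : (w' 1).1.card = 3 := by rw [h] at hw; omega
  -- The only use of coherence. Its common factor `sign (num b - num a)` is removed below by
  -- multiplying with it again.
  have hcoh := T.coherent a b c d hcd _ (w 1).2 _ (w' 1).2 hc1 hc1' (by simp [h1]) (by simp [h1'])
  have hn : T.num b ≠ T.num a := num_ne (w 0).2 (by simp [h0]) (by simp [h0]) hab.symm
  rw [dualSign_one hab hac hbc h0 h1, dualSign_one hab (Ne.symm hd'.2.1) (Ne.symm hd'.2.2)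
    (h ▸ h0) h1']
  rw [sortSign, sortSign] at hcoh
  linear_combination -((T.num b : ℤ) - T.num a).sign * hcoh + sign_sub_mul_self hn *
    ((T.surfaceSign (w 1).1 : ℤ) * (((T.num c : ℤ) - T.num a).sign *
      ((T.num c : ℤ) - T.num b).sign) + (T.surfaceSign (w' 1).1 : ℤ) *
      (((T.num d : ℤ) - T.num a).sign * ((T.num d : ℤ) - T.num b).sign))

/-- Two flags that differ in the edge have opposite orientation. -/
theorem dualSign_two_eq_neg_of_facet {z z' : T.FineCell 2} (h0 : z 0 = z' 0) (h2 : z 2 = z' 2)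
    (hne : z ≠ z') : T.dualSign 2 z = -T.dualSign 2 z' := by
  obtain ⟨a, b, c, hab, hac, hbc, z0, z1, z2⟩ := exists_points z
  obtain ⟨a', b', c', hab', hac', hbc', z0', z1', z2'⟩ := exists_points z'
  have ha : a' = a := by
    have := (z0.symm.trans (congrArg Subtype.val h0)).trans z0'
    simpa using this.symm
  subst ha
  have hf := (z2.symm.trans (congrArg Subtype.val h2)).trans z2'
  have hb' : b' ∈ ({a', b, c} : Finset E) := by rw [hf]; simp
  have hc' : c' ∈ ({a', b, c} : Finset E) := by rw [hf]; simp
  have hbb : b' ≠ b := by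
    rintro rfl
    exact hne (flag_ext h0 (Subtype.ext (z1.trans z1'.symm)) h2)
  simp only [Finset.mem_insert, Finset.mem_singleton] at hb' hc'
  have hb : b' = c := by tauto
  subst hb
  have hc : c' = b := by tauto
  subst hc
  rw [dualSign_two hab hac hbc z0 z1 z2, dualSign_two hab' hac' hbc' z0' z1' z2', h2, sortSign,
    sortSign, sign_sub_comm (T.num b') (T.num c')]
  ring

/-- Two flags that differ in the triangle have opposite orientation. -/
theorem dualSign_two_eq_neg_of_edge {z z' : T.FineCell 2} (h0 : z 0 = z' 0) (h1 : z 1 = z' 1)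
    (hne : z ≠ z') : T.dualSign 2 z = -T.dualSign 2 z' := by
  -- The left-hand sides of the two identities coincide, while the half dual edges on the right are
  -- opposite; hence so are the flags.
  have h := incidence_mul_cellSign z
  have h' := incidence_mul_cellSign z'
  have hn : T.dualSign 1 (z.face 0) = -T.dualSign 1 (z'.face 0) := by
    refine dualSign_one_eq_neg (flag_card z).2.1 h1 fun hf => hne (flag_ext h0 h1 ?_)
    exact congrArg (fun w : T.FineCell 1 => w 1) hf
  have hu := dualSign_one_mul_self (z'.face 0) (flag_card z').2.1
  rw [h0, h1, h', hn] at h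
  have hc := coe_unit_mul_self (T.cellSign (z' 1).1)
  linear_combination ((T.cellSign (z' 1).1 : ℤ) * T.dualSign 1 (z'.face 0)) * h -
    (T.dualSign 2 z + T.dualSign 2 z') * (hu + hc * T.dualSign 1 (z'.face 0) ^ 2)

/-! ### Potentials on the link of a vertex -/

@[simp] theorem face_two_zero_zero (z : T.FineCell 2) : z.face 0 0 = z 1 := rfl
@[simp] theorem face_two_zero_one (z : T.FineCell 2) : z.face 0 1 = z 2 := rfl
@[simp] theorem face_two_one_zero (z : T.FineCell 2) : z.face 1 0 = z 0 := rfl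
@[simp] theorem face_two_one_one (z : T.FineCell 2) : z.face 1 1 = z 2 := rfl
@[simp] theorem face_two_two_zero (z : T.FineCell 2) : z.face 2 0 = z 0 := rfl
@[simp] theorem face_two_two_one (z : T.FineCell 2) : z.face 2 1 = z 1 := rfl
@[simp] theorem face_one_zero_zero (z : T.FineCell 1) : z.face 0 0 = z 1 := rfl
@[simp] theorem face_one_one_zero (z : T.FineCell 1) : z.face 1 0 = z 0 := rfl

/-- All flags at a vertex are reached from one of them by changing edges and triangles. -/
theorem link_induction {p : E} {P : T.FineCell 2 → Prop} {z : T.FineCell 2}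
    (hz : (z 0).1 = {p}) (hP : P z)
    (hedge : ∀ z z' : T.FineCell 2, (z 0).1 = {p} → (z' 0).1 = {p} → z 1 = z' 1 → P z → P z')
    (hfacet : ∀ z z' : T.FineCell 2, (z 0).1 = {p} → (z' 0).1 = {p} → z 2 = z' 2 → P z → P z')
    (z' : T.FineCell 2) (hz' : (z' 0).1 = {p}) : P z' := by
  have hmem : ∀ x : T.FineCell 2, (x 0).1 = {p} → p ∈ (x 2).1 := fun x hx =>
    x.subset (show (0 : Fin 3) ≤ 2 by decide) (by simp [hx])
  have hc := T.link_connected p _ (z 2).2 _ (z' 2).2 (flag_card z).2.2 (flag_card z').2.2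
    (hmem z hz) (hmem z' hz')
  -- The induction along the path of triangles carries `P` for both flags of `g` at `p`, so that the
  -- next step can use the flag through the shared edge.
  suffices h : ∀ g, Relation.ReflTransGen (fun s t : Finset E =>
      t ∈ T.faces ∧ t.card = 3 ∧ p ∈ t ∧ ∃ b, b ≠ p ∧ b ∈ s ∧ b ∈ t) (z 2).1 g →
      g ∈ T.faces ∧ g.card = 3 ∧ p ∈ g ∧ ∀ x : T.FineCell 2, (x 0).1 = {p} → (x 2).1 = g → P x from
    (h _ hc).2.2.2 z' hz' rfl
  intro g hg
  induction hg with
  | refl =>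
    exact ⟨(z 2).2, (flag_card z).2.2, hmem z hz,
      fun x hx hx2 => hfacet z x hz hx (Subtype.ext hx2.symm) hP⟩
  | @tail f g _ hstep ih =>
    obtain ⟨hf, hf3, hpf, hPf⟩ := ih
    obtain ⟨hg, hg3, hpg, b, hbp, hbf, hbg⟩ := hstep
    have hpair : ∀ {s : Finset E}, p ∈ s → b ∈ s → ({p, b} : Finset E) ⊆ s := by
      intro s h1 h2 x hx
      simp only [Finset.mem_insert, Finset.mem_singleton] at hx
      rcases hx with rfl | rfl <;> assumption
    obtain ⟨x, x0, x1, x2⟩ := exists_flag_of_edge_facet hf hf3 (Finset.card_pair hbp.symm)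
      (hpair hpf hbf) (Finset.mem_insert_self p _)
    obtain ⟨y, y0, y1, y2⟩ := exists_flag_of_edge_facet hg hg3 (Finset.card_pair hbp.symm)
      (hpair hpg hbg) (Finset.mem_insert_self p _)
    have hy := hedge x y x0 y0 (Subtype.ext (x1.trans y1.symm)) (hPf x x0 x2)
    exact ⟨hg, hg3, hpg, fun w w0 w2 => hfacet y w y0 w0 (Subtype.ext (y2.trans w2.symm)) hy⟩

/-- By duality: a functional that annihilates all systems of differences `x (z 1) - x (z 2)` takes
opposite values on two flags at `p` that share an edge or a triangle. So does `dualSign`. As the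
link is connected, the functional is a multiple of `dualSign` on these flags, and `hg` says that it
annihilates `g`. -/
theorem exists_link_potential {p : E} (g : T.FineCell 2 → ℝ)
    (hg : ∑ z : T.FineCell 2, (if (z 0).1 = {p} then (T.dualSign 2 z : ℝ) * g z else 0) = 0) :
    ∃ x : T.faces → ℝ, ∀ z : T.FineCell 2, (z 0).1 = {p} → x (z 1) - x (z 2) = g z := by
  by_cases hne : ∃ z : T.FineCell 2, (z 0).1 = {p}
  swap
  · exact ⟨0, fun z hz => (hne ⟨z, hz⟩).elim⟩
  obtain ⟨z₀, hz₀⟩ := hne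
  let A : (T.faces → ℝ) →ₗ[ℝ] (T.FineCell 2 → ℝ) :=
    LinearMap.pi fun z => if (z 0).1 = {p} then
      (LinearMap.proj (z 1) : (T.faces → ℝ) →ₗ[ℝ] ℝ) - LinearMap.proj (z 2) else 0
  have hA : ∀ x z, A x z = if (z 0).1 = {p} then x (z 1) - x (z 2) else 0 := by
    intro x z
    simp only [A, LinearMap.pi_apply]
    split_ifs <;> simp
  let g' : T.FineCell 2 → ℝ := fun z => if (z 0).1 = {p} then g z else 0
  suffices h : g' ∈ LinearMap.range A by
    obtain ⟨x, hx⟩ := h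
    refine ⟨x, fun z hz => ?_⟩
    have := congrFun hx z
    simpa only [hA, g', hz, if_true] using this
  by_contra hcon
  obtain ⟨ℓ, hℓ, hker⟩ := Submodule.exists_le_ker_of_notMem hcon
  set y : T.FineCell 2 → ℝ := fun z => ℓ (Pi.single z 1) with hy
  have hℓy : ∀ u, ℓ u = ∑ z, u z * y z := fun u => by
    have := ℓ.pi_apply_eq_sum_univ u
    rw [this]
    refine Finset.sum_congr rfl fun z _ => ?_
    rw [smul_eq_mul, hy]
    congr 2
    ext j
    simp [Pi.single_apply, eq_comm]
  have hzero : ∀ x, ∑ z, A x z * y z = 0 := fun x => by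
    rw [← hℓy]
    exact hker ⟨x, rfl⟩
  have card_ne : ∀ z z' : T.FineCell 2, z 2 ≠ z' 1 := fun z z' h => by
    have h1 := (flag_card z).2.2
    have h2 := (flag_card z').2.1
    rw [h] at h1
    omega
  have hp2 : ∀ z : T.FineCell 2, (z 0).1 = {p} → p ∈ (z 1).1 ∧ p ∈ (z 2).1 := fun z hz =>
    ⟨z.subset (show (0 : Fin 3) ≤ 1 by decide) (by simp [hz]),
      z.subset (show (0 : Fin 3) ≤ 2 by decide) (by simp [hz])⟩
  have two : ∀ {u v z z' : T.FineCell 2}, z ≠ z' → (z = u ∨ z = v) → (z' = u ∨ z' = v) →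
      y u + y v = 0 → y z = -y z' := by
    rintro u v z z' hne (rfl | rfl) (rfl | rfl) h
    · exact (hne rfl).elim
    · linarith
    · linarith
    · exact (hne rfl).elim
  have hE : ∀ z z' : T.FineCell 2, (z 0).1 = {p} → (z' 0).1 = {p} → z 1 = z' 1 → z ≠ z' →
      y z = -y z' := by
    intro z z' h0 h0' h1 hne
    obtain ⟨u, v, huv, H⟩ := exists_two_flags_edge (z 1).2 (flag_card z).2.1 (hp2 z h0).1
    refine two hne ((H z).1 ⟨h0, rfl⟩) ((H z').1 ⟨h0', by rw [h1]⟩) ?_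
    -- The indicator of an edge isolates the two flags at `p` through it.
    have := hzero (Pi.single (z 1) 1)
    rw [Fintype.sum_eq_add u v huv] at this
    · obtain ⟨hu0, hu1⟩ := (H u).2 (Or.inl rfl)
      obtain ⟨hv0, hv1⟩ := (H v).2 (Or.inr rfl)
      rw [hA, hA, if_pos hu0, if_pos hv0, Subtype.ext hu1, Subtype.ext hv1] at this
      simpa [Pi.single_apply, card_ne u z, card_ne v z] using this
    · rintro x ⟨hxu, hxv⟩
      rw [hA]
      split_ifs with hx
      · have : x 1 ≠ z 1 := fun h => by
          rcases (H x).1 ⟨hx, by rw [h]⟩ with h | h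
          · exact hxu h
          · exact hxv h
        simp [this, card_ne x z]
      · simp
  have hF : ∀ z z' : T.FineCell 2, (z 0).1 = {p} → (z' 0).1 = {p} → z 2 = z' 2 → z ≠ z' →
      y z = -y z' := by
    intro z z' h0 h0' h1 hne
    obtain ⟨u, v, huv, H⟩ := exists_two_flags_facet (z 2).2 (flag_card z).2.2 (hp2 z h0).2
    refine two hne ((H z).1 ⟨h0, rfl⟩) ((H z').1 ⟨h0', by rw [h1]⟩) ?_
    have := hzero (Pi.single (z 2) 1)
    rw [Fintype.sum_eq_add u v huv] at this
    · obtain ⟨hu0, hu1⟩ := (H u).2 (Or.inl rfl)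
      obtain ⟨hv0, hv1⟩ := (H v).2 (Or.inr rfl)
      rw [hA, hA, if_pos hu0, if_pos hv0, Subtype.ext hu1, Subtype.ext hv1] at this
      simp only [Pi.single_apply, (card_ne z u).symm, (card_ne z v).symm, if_true, if_false] at this
      linarith
    · rintro x ⟨hxu, hxv⟩
      rw [hA]
      split_ifs with hx
      · have : x 2 ≠ z 2 := fun h => by
          rcases (H x).1 ⟨hx, by rw [h]⟩ with h | h
          · exact hxu h
          · exact hxv h
        simp [this, (card_ne z x).symm]
      · simp
  have hsq : ∀ z : T.FineCell 2, (T.dualSign 2 z : ℝ) * T.dualSign 2 z = 1 := fun z => by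
    exact_mod_cast dualSign_two_mul_self z
  have hconst : ∀ z : T.FineCell 2, (z 0).1 = {p} →
      y z * T.dualSign 2 z = y z₀ * T.dualSign 2 z₀ := by
    refine link_induction (P := fun z => y z * T.dualSign 2 z = y z₀ * T.dualSign 2 z₀) hz₀ rfl
      ?_ ?_
    · intro z z' h0 h0' h h'
      by_cases hzz : z = z'
      · rwa [← hzz]
      · rw [← h', hE z z' h0 h0' h hzz,
          dualSign_two_eq_neg_of_edge (Subtype.ext (h0.trans h0'.symm)) h hzz]
        push_cast
        ring
    · intro z z' h0 h0' h h'
      by_cases hzz : z = z'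
      · rwa [← hzz]
      · rw [← h', hF z z' h0 h0' h hzz,
          dualSign_two_eq_neg_of_facet (Subtype.ext (h0.trans h0'.symm)) h hzz]
        push_cast
        ring
  apply hℓ
  rw [hℓy, ← mul_zero (y z₀ * T.dualSign 2 z₀), ← hg, Finset.mul_sum]
  refine Finset.sum_congr rfl fun z _ => ?_
  simp only [g']
  split_ifs with hz
  · rw [← hconst z hz]
    linear_combination (-(g z * y z)) * hsq z
  · simp

/-! ### Supports and chain coefficients -/

/-- Every vertex of `t` is reached by descending through subcells, so the support is the union of
the closed dual faces of the vertices of `t`. -/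
theorem mem_supportTriangles {r : ℕ} {t : Finset E} (ht : t ∈ T.faces) (hr : t.card = r + 1)
    {z : T.FineCell 2} : z ∈ T.supportTriangles r t ↔ (z 0).1 ⊆ t := by
  induction r generalizing t with
  | zero =>
    refine ⟨fun h => le_of_eq h, fun h => ?_⟩
    exact Finset.eq_of_subset_of_card_le h (by have := (flag_card z).1; omega)
  | succ r ih =>
    simp only [supportTriangles, Set.mem_iUnion]
    constructor
    · rintro ⟨s, ⟨hs, hsc, hst⟩, hz⟩
      exact ((ih hs hsc).1 hz).trans hst
    · intro h
      obtain ⟨s, hzs, hst, hsc⟩ := Finset.exists_subsuperset_card_eq h (n := r + 1)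
        (by have := (flag_card z).1; omega) (by omega)
      have hs := mem_faces_of_subset ht hst (Finset.card_pos.1 (by omega))
      exact ⟨s, ⟨hs, hsc, hst⟩, (ih hs hsc).2 hzs⟩

theorem mem_support {q : ℕ} {v : T.DualCell q} {z : T.FineCell 2} :
    z ∈ T.support v ↔ (z 0).1 ⊆ v.1 :=
  mem_supportTriangles v.2.1 (by have := v.2.2; have := one_le_card v.2.1; omega)

/-- The flags through `w` start at vertices of `w 0`, and each vertex of `w 0` occurs. So all of
them lie in the support exactly when `w 0 ⊆ v`; otherwise `w` also touches the complement. -/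
theorem not_isIn_or_isInBoundary {q : ℕ} {v : T.DualCell q} {w : T.FineCell q} :
    (¬ T.IsIn w (T.support v) ∨ T.IsInBoundary w (T.support v)) ↔ ¬ (w 0).1 ⊆ v.1 := by
  have key : T.IsIn w (T.support v)ᶜ ↔ ¬ (w 0).1 ⊆ v.1 := by
    constructor
    · rintro ⟨z, hz, hwz⟩ h
      refine hz (mem_support.2 (Finset.Subset.trans ?_ h))
      obtain ⟨j, hj⟩ := hwz ⟨0, rfl⟩
      rw [← hj]
      exact z.subset (Fin.zero_le j)
    · intro h
      obtain ⟨p, hp, hpv⟩ := Finset.not_subset.1 h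
      obtain ⟨z, hz, hwz⟩ := exists_flag w hp
      refine ⟨z, fun hzv => hpv ?_, hwz⟩
      exact mem_support.1 hzv (by simp [hz])
  rw [← key]
  refine ⟨?_, fun h => ?_⟩
  · rintro (h | h)
    · rw [key]
      intro hwv
      obtain ⟨p, hp⟩ := T.nonempty_of_mem_faces (w 0).2
      obtain ⟨z, hz, hwz⟩ := exists_flag w hp
      exact h ⟨z, mem_support.2 (by rw [hz]; simpa using hwv hp), hwz⟩
    · exact h.2
  · by_cases h' : T.IsIn w (T.support v)
    · exact Or.inr ⟨h', h⟩
    · exact Or.inl h'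

theorem abs_eq_one_of_mul_self {m : ℤ} (h : m * m = 1) : |m| = 1 := by
  rcases mul_self_eq_one_iff.1 h with rfl | rfl <;> simp

theorem dualCell_card_two (v : T.DualCell 2) : v.1.card = 1 := by have := v.2.2; omega
theorem dualCell_card_one (v : T.DualCell 1) : v.1.card = 2 := by have := v.2.2; omega
theorem dualCell_card_zero (v : T.DualCell 0) : v.1.card = 3 := v.2.2

theorem chainCoeff_mul_self {q : ℕ} (v : T.DualCell q) (w : T.FineCell q) (h : (w 0).1 = v.1) :
    T.chainCoeff q v w * T.chainCoeff q v w = 1 := by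
  have hd : T.dualSign q w * T.dualSign q w = 1 := by
    match q, v, w with
    | 0, v, w => exact coe_unit_mul_self _
    | 1, v, w => exact dualSign_one_mul_self w (h ▸ dualCell_card_one v)
    | 2, v, w => exact dualSign_two_mul_self w
    | q + 3, v, w => exact ((isEmpty_fineCell (by omega)).false w).elim
  rw [chainCoeff, if_pos h]
  linear_combination coe_unit_mul_self (T.cellSign v.1) * (T.dualSign q w) ^ 2 + hd

theorem chainCoeff_ne_zero {q : ℕ} {v : T.DualCell q} {w : T.FineCell q} :
    T.chainCoeff q v w ≠ 0 ↔ (w 0).1 = v.1 := by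
  refine ⟨fun h => ?_, fun h h0 => ?_⟩
  · by_contra h'
    exact h (if_neg h')
  · have := chainCoeff_mul_self v w h
    rw [h0] at this
    simp at this

theorem dualCount_eq {q : ℕ} (v : T.DualCell q) :
    T.dualCount q v = ∑ w : T.FineCell q, if (w 0).1 = v.1 then 1 else 0 := by
  refine Finset.sum_congr rfl fun w _ => ?_
  split_ifs with h
  · exact abs_eq_one_of_mul_self (chainCoeff_mul_self v w h)
  · rw [chainCoeff, if_neg h, abs_zero]

theorem dualCount_one (v : T.DualCell 1) : T.dualCount 1 v = 2 := by
  obtain ⟨w, w', hne, H⟩ := exists_two_fineEdges v.2.1 (dualCell_card_one v)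
  rw [dualCount_eq, Fintype.sum_eq_add w w' hne]
  · rw [if_pos ((H w).2 (Or.inl rfl)), if_pos ((H w').2 (Or.inr rfl))]
    rfl
  · rintro x ⟨h, h'⟩
    refine if_neg fun hx => ?_
    rcases (H x).1 hx with hx | hx
    · exact h hx
    · exact h' hx

/-- The vertex of the refinement at the barycenter of a cell. -/
def fineVertex (σ : T.faces) : T.FineCell 0 :=
  OrderEmbedding.ofStrictMono ![σ] (by
    intro i j h
    exact absurd h (by simp))

@[simp] theorem fineVertex_zero (σ : T.faces) : fineVertex σ 0 = σ := rfl

theorem dualCount_zero (v : T.DualCell 0) : T.dualCount 0 v = 1 := by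
  rw [dualCount_eq, Finset.sum_eq_single (fineVertex ⟨v.1, v.2.1⟩)]
  · exact if_pos rfl
  · intro w _ hw
    exact if_neg fun h => hw (fineVertex_ext (Subtype.ext h))
  · simp

theorem exists_fineCell {q : ℕ} (v : T.DualCell q) : ∃ w : T.FineCell q, (w 0).1 = v.1 := by
  match q, v with
  | 0, v => exact ⟨fineVertex ⟨v.1, v.2.1⟩, rfl⟩
  | 1, v =>
    obtain ⟨w, w', -, H⟩ := exists_two_fineEdges v.2.1 (dualCell_card_one v)
    exact ⟨w, (H w).2 (Or.inl rfl)⟩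
  | 2, v =>
    obtain ⟨p, hp⟩ := Finset.card_eq_one.1 (dualCell_card_two v)
    obtain ⟨z, hz, -⟩ := exists_flag (fineVertex ⟨v.1, v.2.1⟩) (p := p) (by simp [hp])
    exact ⟨z, hz.trans hp.symm⟩
  | q + 3, v =>
    have := v.2.2
    have := one_le_card v.2.1
    omega

theorem dualCount_pos {q : ℕ} (v : T.DualCell q) : 0 < T.dualCount q v := by
  obtain ⟨w, hw⟩ := exists_fineCell v
  rw [dualCount_eq]
  refine Finset.sum_pos' (fun w _ => by split_ifs <;> simp) ⟨w, Finset.mem_univ _, ?_⟩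
  rw [if_pos hw]
  exact one_pos

/-! ### The coefficients -/

/-- If `p` is a vertex of `t`, two edges of `t` contain it. Up to common factors, each product is
the orientation of the flag from `p` through that edge to `t`, and these two flags are opposite. -/
theorem incidence_comp (p : T.DualCell 2) (t : T.DualCell 0) :
    ∑ s : T.DualCell 1, T.incidence p.1 s.1 * T.incidence s.1 t.1 = 0 := by
  obtain ⟨a, ha⟩ := Finset.card_eq_one.1 (dualCell_card_two p)
  by_cases hat : a ∈ t.1
  · obtain ⟨z, z', hne, H⟩ := exists_two_flags_facet t.2.1 (dualCell_card_zero t) hat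
    obtain ⟨h0, h2⟩ := (H z).2 (Or.inl rfl)
    obtain ⟨h0', h2'⟩ := (H z').2 (Or.inr rfl)
    have e0 : z 0 = z' 0 := Subtype.ext (h0.trans h0'.symm)
    have e2 : z 2 = z' 2 := Subtype.ext (h2.trans h2'.symm)
    have key : ∀ y : T.FineCell 2, (y 0).1 = {a} → (y 2).1 = t.1 →
        T.incidence p.1 (y 1).1 * T.incidence (y 1).1 t.1 =
          -(T.dualSign 2 y * (T.cellSign p.1 * (T.cellSign t.1 * T.surfaceSign t.1))) := by
      intro y y0 y2
      have h1 := incidence_mul_cellSign y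
      have h2 := incidence_eq_neg_dualSign (y.face 0) (flag_card y).2.1
      simp only [face_two_zero_zero, face_two_zero_one] at h2
      rw [y0, ← ha] at h1
      rw [y2] at h2
      rw [h2]
      linear_combination (-(T.cellSign (y 1).1 * T.dualSign 1 (y.face 0)) * T.cellSign p.1 *
        (T.cellSign t.1 * T.surfaceSign t.1)) * h1 + (T.incidence p.1 (y 1).1 *
        (T.cellSign (y 1).1 * T.dualSign 1 (y.face 0)) *
        (T.cellSign t.1 * T.surfaceSign t.1)) * coe_unit_mul_self (T.cellSign p.1) -
        T.dualSign 2 y * (T.cellSign p.1 * (T.cellSign t.1 * T.surfaceSign t.1)) * (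
        coe_unit_mul_self (T.cellSign (y 1).1) * T.dualSign 1 (y.face 0) ^ 2 +
        dualSign_one_mul_self (y.face 0) (flag_card y).2.1)
    have c : ∀ y : T.FineCell 2, (y 1).1.card + 1 = 3 := fun y => by rw [(flag_card y).2.1]
    rw [Fintype.sum_eq_add (⟨(z 1).1, (z 1).2, c z⟩ : T.DualCell 1)
      ⟨(z' 1).1, (z' 1).2, c z'⟩]
    · rw [key z h0 h2, key z' h0' h2', dualSign_two_eq_neg_of_facet e0 e2 hne]
      ring
    · intro h
      exact hne (flag_ext e0 (Subtype.ext (congrArg (fun s : T.DualCell 1 => s.1) h)) e2)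
    · rintro s ⟨hs, hs'⟩
      by_cases hst : s.1 ⊆ t.1
      · by_cases has : p.1 ⊆ s.1
        · obtain ⟨y, y0, y1, y2⟩ := exists_flag_of_edge_facet t.2.1 (dualCell_card_zero t)
            (dualCell_card_one s) hst (p := a) (has (by simp [ha]))
          rcases (H y).1 ⟨y0, y2⟩ with h | h
          · exact (hs (Subtype.ext (by rw [← y1, h]))).elim
          · exact (hs' (Subtype.ext (by rw [← y1, h]))).elim
        · rw [incidence_eq_zero has, zero_mul]
      · rw [incidence_eq_zero hst, mul_zero]
  · refine Finset.sum_eq_zero fun s _ => ?_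
    by_cases hst : s.1 ⊆ t.1
    · rw [incidence_eq_zero (s := p.1), zero_mul]
      exact fun h => hat (hst (h (by simp [ha])))
    · rw [incidence_eq_zero hst, mul_zero]

variable (T) in
/-- The coefficients of the basis `2`-forms. -/
def faceCoeff (v : T.DualCell 2) (z : T.FineCell 2) : ℝ :=
  (T.chainCoeff 2 v z : ℝ) / T.dualCount 2 v

theorem faceCoeff_eq_zero {v : T.DualCell 2} {z : T.FineCell 2} (h : ¬ (z 0).1 = v.1) :
    T.faceCoeff v z = 0 := by
  rw [faceCoeff, chainCoeff, if_neg h]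
  simp

/-- The dual face that contains a triangle of the refinement. -/
def dualFace (z : T.FineCell 2) : T.DualCell 2 :=
  ⟨(z 0).1, (z 0).2, by rw [(flag_card z).1]⟩

theorem sum_incidence_mul_faceCoeff (t : Finset E) (z : T.FineCell 2) :
    ∑ s : T.DualCell 2, (T.incidence s.1 t : ℝ) * T.faceCoeff s z =
      (T.incidence (z 0).1 t : ℝ) * T.faceCoeff (dualFace z) z := by
  rw [Finset.sum_eq_single (dualFace z)]
  · rfl
  · intro s _ hs
    rw [faceCoeff_eq_zero, mul_zero]
    exact fun h => hs (Subtype.ext h.symm)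
  · simp

/-- The conditions that determine the coefficients of the basis `1`-form of a dual edge. -/
structure IsEdgeCoeff (t : T.DualCell 1) (r : T.FineCell 1 → ℝ) : Prop where
  support : ∀ w : T.FineCell 1, ¬ (w 0).1 ⊆ t.1 → r w = 0
  weight : ∀ w : T.FineCell 1, (w 0).1 = t.1 → r w = (T.cellSign t.1 * T.dualSign 1 w : ℤ) / 2
  stability : ∀ w : T.FineCell 1, (w 1).1 ⊆ t.1 → r w = 0
  recursion : ∀ z : T.FineCell 2, (z 0).1 ⊆ t.1 → r (z.face 0) - r (z.face 1) + r (z.face 2) =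
    (T.incidence (z 0).1 t.1 : ℝ) * T.faceCoeff (dualFace z) z

theorem IsEdgeCoeff.eq_zero_of_ne {t : T.DualCell 1} {r : T.FineCell 1 → ℝ} (hr : IsEdgeCoeff t r)
    {w : T.FineCell 1} (hw : (w 0).1.card = 2) (h : (w 0).1 ≠ t.1) : r w = 0 :=
  hr.support w fun h' => h (Finset.eq_of_subset_of_card_le h' (by rw [hw, dualCell_card_one]))

/-- Outside the support all terms vanish, so (4) for `1`-forms holds on the whole surface. -/
theorem IsEdgeCoeff.recursion' {t : T.DualCell 1} {r : T.FineCell 1 → ℝ} (hr : IsEdgeCoeff t r)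
    (z : T.FineCell 2) : r (z.face 0) - r (z.face 1) + r (z.face 2) =
      (T.incidence (z 0).1 t.1 : ℝ) * T.faceCoeff (dualFace z) z := by
  by_cases h : (z 0).1 ⊆ t.1
  · exact hr.recursion z h
  · have h1 : ¬ (z 1).1 ⊆ t.1 := fun h' =>
      h ((z.subset (show (0 : Fin 3) ≤ 1 by decide)).trans h')
    rw [hr.support (z.face 0) h1, hr.support (z.face 1) h, hr.support (z.face 2) h,
      incidence_eq_zero h]
    simp

/-- A cell of the refinement that starts at a vertex is an edge of a flag. -/
theorem exists_flag_of_vertex (w : T.FineCell 1) {p : E} (hw : (w 0).1 = {p}) :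
    ∃ z : T.FineCell 2, (z 0).1 = {p} ∧ (w = z.face 1 ∨ w = z.face 2) := by
  obtain ⟨z, h0, hz⟩ := exists_flag w (p := p) (by simp [hw])
  refine ⟨z, h0, ?_⟩
  obtain ⟨j, hj⟩ := hz ⟨1, rfl⟩
  have h01 := w.card_lt (show (0 : Fin 2) < 1 by decide)
  have e0 : w 0 = z 0 := Subtype.ext (hw.trans h0.symm)
  rw [← hj, e0] at h01
  fin_cases j
  · exact (lt_irrefl _ h01).elim
  · exact Or.inr (fineEdge_ext e0 hj.symm)
  · exact Or.inl (fineEdge_ext e0 hj.symm)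

/-- At `p`, `y (z.face 2)` depends only on the edge `z 1` and `y (z.face 1)` only on the triangle `z
2`, so their equality propagates through both moves of `link_induction`. -/
theorem eq_of_link_const {p : E} {y : T.FineCell 1 → ℝ}
    (hy : ∀ z : T.FineCell 2, (z 0).1 = {p} → y (z.face 1) = y (z.face 2)) {w w' : T.FineCell 1}
    (hw : (w 0).1 = {p}) (hw' : (w' 0).1 = {p}) : y w = y w' := by
  obtain ⟨z, hz, hzw⟩ := exists_flag_of_vertex w hw
  obtain ⟨z', hz', hzw'⟩ := exists_flag_of_vertex w' hw'
  have h : y (z'.face 2) = y (z.face 2) := by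
    refine link_induction (P := fun x => y (x.face 2) = y (z.face 2)) hz rfl ?_ ?_ z' hz'
    · intro x x' h0 h0' h hx
      rw [← hx, fineEdge_ext (w := x.face 2) (w' := x'.face 2)
        (Subtype.ext (h0.trans h0'.symm)) h]
    · intro x x' h0 h0' h hx
      rw [← hx, ← hy x h0, ← hy x' h0', fineEdge_ext (w := x.face 1) (w' := x'.face 1)
        (Subtype.ext (h0.trans h0'.symm)) h]
  have e : y w = y (z.face 2) := by
    rcases hzw with rfl | rfl
    · exact hy z hz
    · rfl
  have e' : y w' = y (z'.face 2) := by
    rcases hzw' with rfl | rfl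
    · exact hy z' hz'
    · rfl
  rw [e, e', h]

/-- Only fine edges from an endpoint `p` of `t` are in question. There the recursion makes the
difference of two solutions constant, and stability makes it zero on the fine edge from `p` along
`t`. -/
theorem IsEdgeCoeff.unique {t : T.DualCell 1} {r r' : T.FineCell 1 → ℝ} (hr : IsEdgeCoeff t r)
    (hr' : IsEdgeCoeff t r') : r = r' := by
  funext w
  by_cases hwt : (w 0).1 ⊆ t.1
  swap
  · rw [hr.support w hwt, hr'.support w hwt]
  by_cases hwe : (w 0).1 = t.1
  · rw [hr.weight w hwe, hr'.weight w hwe]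
  have hc : (w 0).1.card = 1 := by
    have h1 := Finset.card_lt_card (Finset.ssubset_iff_subset_ne.2 ⟨hwt, hwe⟩)
    have h2 := one_le_card (w 0).2
    rw [dualCell_card_one] at h1
    omega
  obtain ⟨p, hp⟩ := Finset.card_eq_one.1 hc
  have hpt : p ∈ t.1 := hwt (by simp [hp])
  obtain ⟨z₀, _, -, H⟩ := exists_two_flags_edge t.2.1 (dualCell_card_one t) hpt
  obtain ⟨h0, h1⟩ := (H z₀).2 (Or.inl rfl)
  have hst : ((z₀.face 2) 1).1 ⊆ t.1 := h1.le
  have h := eq_of_link_const (y := fun w => r w - r' w) ?_ hp (show ((z₀.face 2) 0).1 = {p} from h0)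
  · simp only [hr.stability _ hst, hr'.stability _ hst] at h
    linarith
  · intro z _
    have e1 := hr.recursion' z
    have e2 := hr'.recursion' z
    have e3 : r (z.face 0) = r' (z.face 0) := by
      by_cases h : (z 1).1 = t.1
      · rw [hr.weight _ h, hr'.weight _ h]
      · rw [hr.eq_zero_of_ne (w := z.face 0) (flag_card z).2.1 h,
          hr'.eq_zero_of_ne (w := z.face 0) (flag_card z).2.1 h]
    linarith

/-- `x σ` will be the coefficient of the fine edge from `p` to the barycenter of `σ`. Its vanishing
at `t` is stability; the equation is the recursion with the known value on `z.face 0` moved to the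
right. -/
theorem exists_vertex_potential (t : T.DualCell 1) (p : E) (hp : p ∈ t.1) :
    ∃ x : T.faces → ℝ, x ⟨t.1, t.2.1⟩ = 0 ∧ ∀ z : T.FineCell 2, (z 0).1 = {p} →
      x (z 1) - x (z 2) = (T.incidence (z 0).1 t.1 : ℝ) * T.faceCoeff (dualFace z) z -
        if (z 1).1 = t.1 then
          ((T.cellSign t.1 * T.dualSign 1 (z.face 0) : ℤ) : ℝ) / 2 else 0 := by
  have hpf : ({p} : Finset E) ∈ T.faces := mem_faces_of_subset t.2.1 (by simpa using hp) (by simp)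
  let v : T.DualCell 2 := ⟨{p}, hpf, rfl⟩
  suffices h : ∑ z : T.FineCell 2, (if (z 0).1 = {p} then (T.dualSign 2 z : ℝ) *
      ((T.incidence (z 0).1 t.1 : ℝ) * T.faceCoeff (dualFace z) z -
        if (z 1).1 = t.1 then
          ((T.cellSign t.1 * T.dualSign 1 (z.face 0) : ℤ) : ℝ) / 2 else 0) else 0) = 0 by
    obtain ⟨x, hx⟩ := exists_link_potential _ h
    refine ⟨fun σ => x σ - x ⟨t.1, t.2.1⟩, sub_self _, fun z hz => ?_⟩
    rw [← hx z hz]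
    ring
  -- `K` is the total of both contributions: `dualCount` fine triangles of weight `K / dualCount`,
  -- against two half dual edges of weight `K / 2`.
  set K : ℝ := ((T.incidence {p} t.1 * T.cellSign {p} : ℤ) : ℝ) with hK
  have hsq : ∀ z : T.FineCell 2, (T.dualSign 2 z : ℝ) * T.dualSign 2 z = 1 := fun z => by
    exact_mod_cast dualSign_two_mul_self z
  have e1 : ∀ z : T.FineCell 2, (if (z 0).1 = {p} then (T.dualSign 2 z : ℝ) *
      ((T.incidence (z 0).1 t.1 : ℝ) * T.faceCoeff (dualFace z) z -
        if (z 1).1 = t.1 then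
          ((T.cellSign t.1 * T.dualSign 1 (z.face 0) : ℤ) : ℝ) / 2 else 0) else 0) =
      K / T.dualCount 2 v * (if (z 0).1 = v.1 then 1 else 0) -
        K / 2 * (if (z 0).1 = {p} ∧ (z 1).1 = t.1 then 1 else 0) := by
    intro z
    by_cases hz : (z 0).1 = {p}
    · have hv : dualFace z = v := Subtype.ext hz
      have hf : T.faceCoeff (dualFace z) z =
          (T.cellSign {p} : ℤ) * T.dualSign 2 z / T.dualCount 2 v := by
        rw [hv, faceCoeff, chainCoeff, if_pos hz]
        push_cast
        rfl
      have hvp : v.1 = {p} := rfl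
      simp only [hz, hf, hvp, true_and, if_true]
      by_cases h1 : (z 1).1 = t.1
      · have h := incidence_mul_cellSign z
        rw [hz, h1] at h
        have h' : K = T.dualSign 2 z * ((T.cellSign t.1 * T.dualSign 1 (z.face 0) : ℤ) : ℝ) := by
          rw [hK, h]
          push_cast
          ring
        simp only [h1, if_true]
        have hK' : K = (T.incidence {p} t.1 : ℝ) * (T.cellSign {p} : ℤ) := by
          rw [hK]
          push_cast
          rfl
        linear_combination ((T.incidence {p} t.1 : ℝ) * (T.cellSign {p} : ℤ) /
          T.dualCount 2 v) * hsq z - (T.dualCount 2 v : ℝ)⁻¹ * hK' + 2⁻¹ * h'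
      · simp only [h1, if_false]
        rw [hK]
        push_cast
        linear_combination ((T.incidence {p} t.1 : ℝ) * (T.cellSign {p} : ℤ) /
          T.dualCount 2 v) * hsq z
    · have : ¬ (z 0).1 = v.1 := hz
      simp [hz, this]
  rw [Finset.sum_congr rfl fun z _ => e1 z, Finset.sum_sub_distrib, ← Finset.mul_sum,
    ← Finset.mul_sum]
  have e2 : (∑ z : T.FineCell 2, if (z 0).1 = v.1 then (1 : ℝ) else 0) = T.dualCount 2 v := by
    rw [dualCount_eq]
    push_cast
    rfl
  have e3 : (∑ z : T.FineCell 2, if (z 0).1 = {p} ∧ (z 1).1 = t.1 then (1 : ℝ) else 0) = 2 := by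
    obtain ⟨z, z', hne, H⟩ := exists_two_flags_edge t.2.1 (dualCell_card_one t) hp
    rw [Fintype.sum_eq_add z z' hne]
    · rw [if_pos ((H z).2 (Or.inl rfl)), if_pos ((H z').2 (Or.inr rfl))]
      norm_num
    · rintro y ⟨h, h'⟩
      refine if_neg fun hy => ?_
      rcases (H y).1 hy with hy | hy
      · exact h hy
      · exact h' hy
  have hpos : (T.dualCount 2 v : ℝ) ≠ 0 := by exact_mod_cast (dualCount_pos v).ne'
  rw [e2, e3]
  field_simp
  ring

theorem exists_isEdgeCoeff (t : T.DualCell 1) : ∃ r : T.FineCell 1 → ℝ, IsEdgeCoeff t r := by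
  choose x hx0 hx using exists_vertex_potential t
  let r : T.FineCell 1 → ℝ := fun w => if (w 0).1 = t.1 then
    ((T.cellSign t.1 * T.dualSign 1 w : ℤ) : ℝ) / 2
    else if h : ∃ p, p ∈ t.1 ∧ (w 0).1 = {p} then x h.choose h.choose_spec.1 (w 1) else 0
  have hr1 : ∀ w : T.FineCell 1, ∀ p (hp : p ∈ t.1), (w 0).1 = {p} → r w = x p hp (w 1) := by
    intro w p hp hw
    have hne : ¬ (w 0).1 = t.1 := fun h => by
      have := dualCell_card_one t
      rw [← h, hw] at this
      simp at this
    have hex : ∃ p, p ∈ t.1 ∧ (w 0).1 = {p} := ⟨p, hp, hw⟩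
    have hch : hex.choose = p :=
       Finset.singleton_injective (hex.choose_spec.2.symm.trans hw)
    simp only [r, if_neg hne, dif_pos hex, hch]
  have hr2 : ∀ w : T.FineCell 1, (w 0).1 = t.1 →
      r w = ((T.cellSign t.1 * T.dualSign 1 w : ℤ) : ℝ) / 2 := fun w hw => if_pos hw
  have hr0 : ∀ w : T.FineCell 1, ¬ (w 0).1 ⊆ t.1 → r w = 0 := by
    intro w hw
    have h1 : ¬ (w 0).1 = t.1 := fun h => hw h.le
    have h2 : ¬ ∃ p, p ∈ t.1 ∧ (w 0).1 = {p} := by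
      rintro ⟨p, hp, h⟩
      exact hw (by rw [h]; simpa using hp)
    simp only [r, if_neg h1, dif_neg h2]
  refine ⟨r, hr0, hr2, ?_, ?_⟩
  · intro w hw
    have hlt := w.card_lt (show (0 : Fin 2) < 1 by decide)
    have hle := Finset.card_le_card hw
    have h2 := dualCell_card_one t
    have h0 := one_le_card (w 0).2
    obtain ⟨p, hp⟩ := Finset.card_eq_one.1 (show (w 0).1.card = 1 by omega)
    have hpt : p ∈ t.1 := hw (w.subset (show (0 : Fin 2) ≤ 1 by decide) (by simp [hp]))
    have h1 : w 1 = ⟨t.1, t.2.1⟩ :=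
      Subtype.ext (Finset.eq_of_subset_of_card_le hw (by rw [h2]; omega))
    rw [hr1 w p hpt hp, h1, hx0]
  · intro z hz
    obtain ⟨p, hp⟩ := Finset.card_eq_one.1 (flag_card z).1
    have hpt : p ∈ t.1 := hz (by simp [hp])
    have h := hx p hpt z hp
    rw [hr1 (z.face 1) p hpt hp, hr1 (z.face 2) p hpt hp]
    have e0 : r (z.face 0) = if (z 1).1 = t.1 then
        ((T.cellSign t.1 * T.dualSign 1 (z.face 0) : ℤ) : ℝ) / 2 else 0 := by
      split_ifs with h1
      · exact hr2 _ h1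
      · refine hr0 _ fun h' => h1 (Finset.eq_of_subset_of_card_le h' ?_)
        rw [dualCell_card_one]
        exact (flag_card z).2.1.ge
    simp only [face_two_one_one, face_two_two_one]
    rw [e0]
    linarith

variable (T) in
/-- The coefficients of the basis `1`-form of a dual edge. -/
def edgeCoeff (t : T.DualCell 1) : T.FineCell 1 → ℝ := (exists_isEdgeCoeff t).choose

theorem isEdgeCoeff_edgeCoeff (t : T.DualCell 1) : IsEdgeCoeff t (T.edgeCoeff t) :=
  (exists_isEdgeCoeff t).choose_spec

variable (T) in
/-- The coefficients of the boundary of a dual vertex in terms of the dual edges. -/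
def edgeSum (t : T.DualCell 0) (w : T.FineCell 1) : ℝ :=
  ∑ s : T.DualCell 1, (T.incidence s.1 t.1 : ℝ) * T.edgeCoeff s w

/-- A fine triangle lies in a single dual face, so the recursion turns the left-hand side into a sum
of products of incidence numbers times one coefficient of a `2`-form. -/
theorem edgeSum_cocycle (t : T.DualCell 0) (z : T.FineCell 2) :
    T.edgeSum t (z.face 0) - T.edgeSum t (z.face 1) + T.edgeSum t (z.face 2) = 0 := by
  have h : ((∑ s : T.DualCell 1, T.incidence (dualFace z).1 s.1 * T.incidence s.1 t.1 : ℤ) : ℝ)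
      * T.faceCoeff (dualFace z) z = 0 := by
    rw [incidence_comp]
    simp
  rw [edgeSum, edgeSum, edgeSum, ← Finset.sum_sub_distrib, ← Finset.sum_add_distrib, ← h]
  push_cast
  rw [Finset.sum_mul]
  refine Finset.sum_congr rfl fun s _ => ?_
  rw [← mul_sub, ← mul_add, (isEdgeCoeff_edgeCoeff s).recursion' z]
  simp only [dualFace]
  ring

variable (T) in
/-- The coefficients of the basis `0`-form of a dual vertex. -/
def vertexCoeff (t : T.DualCell 0) (w : T.FineCell 0) : ℝ :=
  if (w 0).1 ⊆ t.1 then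
    -- The first term is the value that (2) prescribes at the barycenter of `t`; (4) on the fine
    -- edge from `w 0` to it forces the correction.
    (T.cellSign t.1 * T.surfaceSign t.1 : ℤ) + (if h : w 0 < ⟨t.1, t.2.1⟩ then
      T.edgeSum t (fineEdge (w 0) ⟨t.1, t.2.1⟩ h) else 0) else 0

theorem vertexCoeff_eq_zero {t : T.DualCell 0} {w : T.FineCell 0} (h : ¬ (w 0).1 ⊆ t.1) :
    T.vertexCoeff t w = 0 := if_neg h

theorem vertexCoeff_self {t : T.DualCell 0} {w : T.FineCell 0} (h : (w 0).1 = t.1) :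
    T.vertexCoeff t w = (T.cellSign t.1 * T.surfaceSign t.1 : ℤ) := by
  have h0 : w 0 = ⟨t.1, t.2.1⟩ := Subtype.ext h
  rw [vertexCoeff, if_pos h.le, dif_neg (by rw [h0]; exact lt_irrefl _), add_zero]

theorem vertexCoeff_of_lt {t : T.DualCell 0} {w : T.FineCell 1} (h : (w 1).1 = t.1) :
    T.vertexCoeff t (w.face 1) =
      (T.cellSign t.1 * T.surfaceSign t.1 : ℤ) + T.edgeSum t w := by
  have h1 : w 1 = ⟨t.1, t.2.1⟩ := Subtype.ext h
  have hlt : w 0 < ⟨t.1, t.2.1⟩ := h1 ▸ w.strictMono (show (0 : Fin 2) < 1 by decide)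
  have h2 : fineEdge (w 0) ⟨t.1, t.2.1⟩ hlt = w := fineEdge_ext rfl h1.symm
  have hs : (w 0).1 ⊆ t.1 := h ▸ w.subset (show (0 : Fin 2) ≤ 1 by decide)
  rw [vertexCoeff, face_one_one_zero, if_pos hs, dif_pos hlt, h2]

/-- On fine edges that end at the barycenter of `t` this is the definition. Any other one in `t`
spans a fine triangle with that barycenter, to which the cocycle identity applies. -/
theorem vertexCoeff_recursion (t : T.DualCell 0) (w : T.FineCell 1) (h : (w 1).1 ⊆ t.1) :
    T.vertexCoeff t (w.face 0) - T.vertexCoeff t (w.face 1) = -T.edgeSum t w := by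
  by_cases h1 : (w 1).1 = t.1
  · rw [vertexCoeff_of_lt h1, vertexCoeff_self (w := w.face 0) h1]
    ring
  · have hlt : w 1 < ⟨t.1, t.2.1⟩ := Finset.ssubset_iff_subset_ne.2 ⟨h, h1⟩
    let z : T.FineCell 2 :=
      flag (w 0) (w 1) ⟨t.1, t.2.1⟩ (w.strictMono (show (0 : Fin 2) < 1 by decide)) hlt
    have e0 : w.face 0 = (z.face 0).face 1 := fineVertex_ext rfl
    have e1 : w.face 1 = (z.face 1).face 1 := fineVertex_ext rfl
    have e2 : w = z.face 2 := fineEdge_ext rfl rfl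
    have hz := edgeSum_cocycle t z
    rw [e0, e1, vertexCoeff_of_lt (w := z.face 0) rfl, vertexCoeff_of_lt (w := z.face 1) rfl,
      ← e2] at *
    linarith

variable (T) in
/-- The coefficients of the Buffa-Christiansen basis forms. -/
def bcCoeff : T.Coefficients
  | 0 => T.vertexCoeff
  | 1 => T.edgeCoeff
  | 2 => T.faceCoeff
  | _ + 3 => 0

/-! ### Existence and uniqueness of the coefficients -/

theorem isBuffaChristiansen_bcCoeff : T.IsBuffaChristiansen (bcCoeff T) where
  local_support q v w h := by
    rw [not_isIn_or_isInBoundary] at h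
    match q, v, w, h with
    | 0, v, w, h => exact vertexCoeff_eq_zero h
    | 1, v, w, h => exact (isEdgeCoeff_edgeCoeff v).support w h
    | 2, v, w, h => exact faceCoeff_eq_zero fun h' => h h'.le
    | q + 3, v, w, h => rfl
  same_weight q v w h := by
    have h0 := chainCoeff_ne_zero.1 h
    match q, v, w, h0 with
    | 0, v, w, h0 =>
      rw [dualCount_zero, chainCoeff, if_pos h0]
      simp only [bcCoeff, Int.cast_one, div_one]
      rw [vertexCoeff_self h0, dualSign, h0]
    | 1, v, w, h0 =>
      rw [dualCount_one, chainCoeff, if_pos h0]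
      exact_mod_cast (isEdgeCoeff_edgeCoeff v).weight w h0
    | 2, v, w, h0 => rfl
    | q + 3, v, w, h0 => exact ((isEmpty_fineCell (by omega)).false w).elim
  stability v w h := (isEdgeCoeff_edgeCoeff v).stability w h
  recursion_one t z hz := by
    have h := (isEdgeCoeff_edgeCoeff t).recursion z (mem_support.1 hz)
    simp only [bcCoeff]
    rw [sum_incidence_mul_faceCoeff, ← h, Fin.sum_univ_three]
    simp
    ring
  recursion_zero t z hz := by
    have h := vertexCoeff_recursion t z hz
    simp only [bcCoeff]
    rw [edgeSum] at h
    rw [← h, Fin.sum_univ_two]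
    simp
    ring

/-- Degrees `2`, `1`, `0` are determined in turn, since (4) expresses each in terms of the next
higher one. -/
theorem IsBuffaChristiansen.eq_bcCoeff {R : T.Coefficients} (hR : T.IsBuffaChristiansen R) :
    R = bcCoeff T := by
  have hs : ∀ q (v : T.DualCell q) (w : T.FineCell q), ¬ (w 0).1 ⊆ v.1 → R q v w = 0 :=
    fun q v w h => hR.local_support q v w (not_isIn_or_isInBoundary.2 h)
  have h2 : R 2 = T.faceCoeff := by
    funext v w
    by_cases h : (w 0).1 = v.1
    · exact hR.same_weight 2 v w (chainCoeff_ne_zero.2 h)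
    · rw [faceCoeff_eq_zero h]
      refine hs 2 v w fun h' => h (Finset.eq_of_subset_of_card_le h' ?_)
      rw [dualCell_card_two, (flag_card w).1]
  have h1 : R 1 = T.edgeCoeff := by
    funext v
    refine IsEdgeCoeff.unique (t := v) ⟨hs 1 v, ?_, hR.stability v, ?_⟩ (isEdgeCoeff_edgeCoeff v)
    · intro w hw
      have := hR.same_weight 1 v w (chainCoeff_ne_zero.2 hw)
      rw [dualCount_one, chainCoeff, if_pos hw] at this
      exact_mod_cast this
    · intro z hz
      have := hR.recursion_one v z (mem_support.2 hz)
      rw [h2, sum_incidence_mul_faceCoeff, Fin.sum_univ_three] at this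
      rw [← this]
      simp
      ring
  have h0 : R 0 = T.vertexCoeff := by
    funext v w
    have hself : ∀ w : T.FineCell 0, (w 0).1 = v.1 → R 0 v w = T.vertexCoeff v w := by
      intro w h
      rw [vertexCoeff_self h, hR.same_weight 0 v w (chainCoeff_ne_zero.2 h), dualCount_zero,
        chainCoeff, if_pos h, dualSign, h, Int.cast_one, div_one]
    by_cases h : (w 0).1 ⊆ v.1
    · by_cases he : (w 0).1 = v.1
      · exact hself w he
      · have hlt : w 0 < ⟨v.1, v.2.1⟩ := Finset.ssubset_iff_subset_ne.2 ⟨h, he⟩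
        -- On the fine edge from `w` to the barycenter of `v`, (4) contains only one unknown value.
        let y : T.FineCell 1 := fineEdge (w 0) ⟨v.1, v.2.1⟩ hlt
        have e : y.face 1 = w := fineVertex_ext rfl
        have a1 := hR.recursion_zero v y (le_refl _)
        have a2 := vertexCoeff_recursion v y (le_refl _)
        rw [h1, Fin.sum_univ_two] at a1
        rw [edgeSum] at a2
        have a3 := hself (y.face 0) rfl
        rw [← a2, a3, e] at a1
        simp only [Fin.coe_ofNat_eq_mod, Nat.zero_mod, pow_zero, one_mul, Nat.mod_succ, pow_one]
          at a1
        linarith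
    · rw [vertexCoeff_eq_zero h, hs 0 v w h]
  funext q v w
  match q, v, w with
  | 0, v, w => rw [h0]; rfl
  | 1, v, w => rw [h1]; rfl
  | 2, v, w => rw [h2]; rfl
  | q + 3, v, w => exact ((isEmpty_fineCell (by omega)).false w).elim

/-- The basis `0`-form of a dual vertex has exterior derivative `-∑ s, D s t • μ (⋆s)`. -/
theorem vertexCoeff_recursion_everywhere (t : T.DualCell 0) (w : T.FineCell 1) :
    T.vertexCoeff t (w.face 0) - T.vertexCoeff t (w.face 1) = -T.edgeSum t w := by
  -- `y` is the defect of the identity. It is a cocycle, so once it vanishes on fine edges that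
  -- start at a mesh edge, it is constant on the fine edges at each vertex.
  let y : T.FineCell 1 → ℝ := fun w =>
    T.vertexCoeff t (w.face 0) - T.vertexCoeff t (w.face 1) + T.edgeSum t w
  suffices h : ∀ w, y w = 0 by
    have := h w
    simp only [y] at this
    linarith
  have hin : ∀ w : T.FineCell 1, (w 1).1 ⊆ t.1 → y w = 0 := fun w hw => by
    simp only [y]
    rw [vertexCoeff_recursion t w hw]
    ring
  have hcoc : ∀ z : T.FineCell 2, y (z.face 0) - y (z.face 1) + y (z.face 2) = 0 := by
    intro z
    have h := edgeSum_cocycle t z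
    have e1 : (z.face 0).face 0 = (z.face 1).face 0 := fineVertex_ext rfl
    have e2 : (z.face 0).face 1 = (z.face 2).face 0 := fineVertex_ext rfl
    have e3 : (z.face 1).face 1 = (z.face 2).face 1 := fineVertex_ext rfl
    simp only [y]
    rw [e1, e2, e3]
    linarith
  have hout : ∀ w : T.FineCell 1, ¬ (w 0).1 ⊆ t.1 → y w = 0 := by
    intro w hw
    have hw1 : ¬ (w 1).1 ⊆ t.1 := fun h =>
      hw ((w.subset (show (0 : Fin 2) ≤ 1 by decide)).trans h)
    simp only [y]
    rw [vertexCoeff_eq_zero (w := w.face 0) hw1, vertexCoeff_eq_zero (w := w.face 1) hw, edgeSum,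
      Finset.sum_eq_zero]
    · ring
    · intro s _
      by_cases hst : s.1 ⊆ t.1
      · rw [(isEdgeCoeff_edgeCoeff s).support w fun h => hw (h.trans hst), mul_zero]
      · rw [incidence_eq_zero hst, Int.cast_zero, zero_mul]
  -- Only the basis form of `⋆(w 0)` has a nonzero coefficient on a half `w` of this dual edge.
  have hsum : ∀ w : T.FineCell 1, ∀ hw : (w 0).1.card = 2, T.edgeSum t w =
      (T.incidence (w 0).1 t.1 : ℝ) *
        (((T.cellSign (w 0).1 * T.dualSign 1 w : ℤ) : ℝ) / 2) := by
    intro w hw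
    have hc : (w 0).1.card + 1 = 3 := by omega
    rw [edgeSum, Finset.sum_eq_single (⟨(w 0).1, (w 0).2, hc⟩ : T.DualCell 1)]
    · rw [(isEdgeCoeff_edgeCoeff ⟨(w 0).1, (w 0).2, hc⟩).weight w rfl]
    · intro s _ hs
      rw [(isEdgeCoeff_edgeCoeff s).eq_zero_of_ne hw fun h => hs (Subtype.ext h.symm), mul_zero]
    · simp
  have hedge : ∀ w : T.FineCell 1, (w 0).1.card = 2 → y w = 0 := by
    intro w hw
    by_cases h0 : (w 0).1 ⊆ t.1
    · by_cases h1 : (w 1).1 ⊆ t.1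
      · exact hin w h1
      · have hne : (w 0).1 ≠ t.1 := fun h => by
          rw [h, dualCell_card_zero] at hw
          omega
        have hlt : w 0 < ⟨t.1, t.2.1⟩ := Finset.ssubset_iff_subset_ne.2 ⟨h0, hne⟩
        -- `w'` is the half of the dual edge inside `t`, and `w` the half outside. The `0`-form
        -- drops from `±1` at the barycenter of `t` to `±1/2` on the mesh edge and to `0` beyond;
        -- each half accounts for one drop.
        let w' : T.FineCell 1 := fineEdge (w 0) ⟨t.1, t.2.1⟩ hlt
        have hww : w ≠ w' := fun h => h1 (by rw [h]; exact le_refl t.1)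
        have e : w.face 1 = w'.face 1 := fineVertex_ext rfl
        have hd := dualSign_one_eq_neg hw (show w 0 = w' 0 from rfl) hww
        have hi := incidence_eq_neg_dualSign w' hw
        have hi' : T.incidence (w 0).1 t.1 = -((T.cellSign (w 0).1 * T.dualSign 1 w') *
          (T.cellSign t.1 * T.surfaceSign t.1)) := hi
        have hu := coe_unit_mul_self (T.cellSign (w 0).1)
        have hv := dualSign_one_mul_self w' hw
        simp only [y]
        rw [vertexCoeff_eq_zero (w := w.face 0) h1, e, vertexCoeff_of_lt (w := w') rfl,
          hsum w hw, hsum w' hw, hd, show w' 0 = w 0 from rfl, hi']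
        have hu' : ((T.cellSign (w 0).1 : ℤ) : ℝ) * ((T.cellSign (w 0).1 : ℤ) : ℝ) = 1 := by
          exact_mod_cast hu
        have hv' : (T.dualSign 1 w' : ℝ) * T.dualSign 1 w' = 1 := by exact_mod_cast hv
        push_cast
        linear_combination (((T.cellSign t.1 : ℤ) : ℝ) * ((T.surfaceSign t.1 : ℤ) : ℝ)) *
          (hu' * (T.dualSign 1 w' : ℝ) ^ 2 + hv')
    · exact hout w h0
  intro w
  by_cases h0 : (w 0).1 ⊆ t.1
  swap
  · exact hout w h0
  by_cases h1 : (w 1).1 ⊆ t.1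
  · exact hin w h1
  by_cases h2 : (w 0).1.card = 2
  · exact hedge w h2
  have hc : (w 0).1.card = 1 := by
    have h3 := w.card_lt (show (0 : Fin 2) < 1 by decide)
    have h4 := card_le_three (w 1).2
    have h5 := one_le_card (w 0).2
    omega
  obtain ⟨p, hp⟩ := Finset.card_eq_one.1 hc
  obtain ⟨z, hz0, hz2⟩ := exists_flag_of_facet t.2.1 (dualCell_card_zero t) (p := p)
    (h0 (by simp [hp]))
  -- Comparison with the fine edge from `p` to the barycenter of `t`, where the defect is known to
  -- vanish.
  rw [← hin (z.face 1) hz2.le]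
  refine eq_of_link_const (fun z _ => ?_) hp hz0
  have h3 := hcoc z
  rw [hedge (z.face 0) (flag_card z).2.1] at h3
  linarith

/-! ### Whitney forms -/

/-- The value of a form on a triangle, at a point and a family of tangent vectors. -/
def evalForm {q : ℕ} (z : T.FineCell 2) (x : T.tangent z) (v : Fin q → T.tangent z) :
    T.Form q →ₗ[ℝ] ℝ where
  toFun ω := (ω z).1 x v
  map_add' _ _ := rfl
  map_smul' _ _ := rfl

theorem form_ext {q : ℕ} {ω η : T.Form q}
    (h : ∀ z (x : T.tangent z) v, evalForm z x v ω = evalForm z x v η) : ω = η :=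
  funext fun z => Subtype.ext <| funext fun x => ContinuousAlternatingMap.ext fun v => h z x v

theorem hat_of_notMem {z : T.FineCell 2} {σ : T.faces} (h : σ ∉ Set.range z) : T.hat z σ = 0 :=
  Finset.sum_eq_zero fun i _ => if_neg fun hi => h ⟨i, hi⟩

theorem hat_apply_self (z : T.FineCell 2) (i : Fin 3) :
    T.hat z (z i) = (T.triangleBasis z).coord i := by
  rw [hat, Finset.sum_eq_single i]
  · exact if_pos rfl
  · exact fun j _ hj => if_neg fun h => hj (z.injective h)
  · simp

theorem dHat_of_notMem {z : T.FineCell 2} {σ : T.faces} (h : σ ∉ Set.range z) :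
    T.dHat z σ = 0 := by
  ext x
  rw [dHat, hat_of_notMem h]
  rfl

theorem dHat_sub (z : T.FineCell 2) (σ : T.faces) (x y : T.tangent z) :
    T.dHat z σ (x - y) = T.hat z σ x - T.hat z σ y := by
  have := (T.hat z σ).linearMap_vsub x y
  rw [dHat, LinearMap.coe_toContinuousLinearMap']
  simpa using this

theorem hat_chartPoint (z : T.FineCell 2) (σ : T.faces) (k : Fin 3) :
    T.hat z σ (T.chartPoint z k) = if z k = σ then 1 else 0 := by
  by_cases h : σ ∈ Set.range z
  · obtain ⟨i, rfl⟩ := h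
    rw [hat_apply_self]
    have := (T.triangleBasis z).coord_apply i k
    rw [show T.chartPoint z k = T.triangleBasis z k from rfl, this]
    simp [eq_comm]
  · rw [hat_of_notMem h, if_neg fun hk => h ⟨k, hk⟩]
    rfl

theorem sum_hat (z : T.FineCell 2) (x : T.tangent z) : ∑ i, T.hat z (z i) x = 1 := by
  simp only [hat_apply_self]
  exact (T.triangleBasis z).sum_coord_apply_eq_one x

theorem sum_dHat (z : T.FineCell 2) (x : T.tangent z) : ∑ i, T.dHat z (z i) x = 0 := by
  have h := fun i => dHat_sub z (z i) x 0
  simp only [sub_zero] at h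
  simp only [h, Finset.sum_sub_distrib, sum_hat, sub_self]

theorem hasFDerivAt_hat (z : T.FineCell 2) (σ : T.faces) (x : T.tangent z) :
    HasFDerivAt (fun y => T.hat z σ y) (T.dHat z σ) x := by
  have h : (fun x : T.tangent z => T.hat z σ x) = fun x => T.dHat z σ x + T.hat z σ 0 :=
    (T.hat z σ).decomp
  rw [h]
  exact (T.dHat z σ).hasFDerivAt.add_const _

theorem evalForm_whitney {q : ℕ} (z : T.FineCell 2) (x : T.tangent z) (v : Fin q → T.tangent z)
    (w : T.FineCell q) : evalForm z x v (T.whitney q w) =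
      (q ! : ℝ) * ∑ i : Fin (q + 1), (-1 : ℝ) ^ (i : ℕ) * T.hat z (w i) x *
        (Matrix.of fun j k => T.dHat z (w (i.succAbove j)) (v k)).det := by
  change ((q ! : ℝ) • ∑ i : Fin (q + 1), ((-1 : ℝ) ^ (i : ℕ) * T.hat z (w i) x) •
      wedge fun j : Fin q => T.dHat z (w (i.succAbove j))) v = _
  simp only [ContinuousAlternatingMap.smul_apply, ContinuousAlternatingMap.sum_apply, smul_eq_mul,
    wedge_apply]

/-- The covectors `dHat` are constant, so only the factors `hat` are differentiated. -/
theorem evalForm_d_whitney {q : ℕ} (z : T.FineCell 2) (x : T.tangent z)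
    (v : Fin (q + 1) → T.tangent z) (w : T.FineCell q) :
    evalForm z x v (T.d q (T.whitney q w)) =
      (q ! : ℝ) * ∑ l : Fin (q + 1), (-1 : ℝ) ^ (l : ℕ) * ∑ i : Fin (q + 1),
        (-1 : ℝ) ^ (i : ℕ) * T.dHat z (w i) (v l) *
        (Matrix.of fun j k => T.dHat z (w (i.succAbove j)) (l.removeNth v k)).det := by
  have h0 : evalForm z x v (T.d q (T.whitney q w)) = extDeriv (T.whitney q w z).1 x v := rfl
  have hd : DifferentiableAt ℝ (T.whitney q w z).1 x :=
    (SmoothForm.contDiff_coe _).differentiable (by simp) x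
  rw [h0, extDeriv_apply hd, Finset.mul_sum]
  refine Finset.sum_congr rfl fun l _ => ?_
  have h1 : (fun y => (T.whitney q w z).1 y (l.removeNth v)) = fun y =>
      (q ! : ℝ) * ∑ i : Fin (q + 1), ((-1 : ℝ) ^ (i : ℕ) * T.hat z (w i) y) *
        (Matrix.of fun j k => T.dHat z (w (i.succAbove j)) (l.removeNth v k)).det :=
    funext fun y => evalForm_whitney z y (l.removeNth v) w
  have h2 : HasFDerivAt (fun y => (T.whitney q w z).1 y (l.removeNth v))
      ((q ! : ℝ) • ∑ i : Fin (q + 1),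
        (Matrix.of fun j k => T.dHat z (w (i.succAbove j)) (l.removeNth v k)).det •
          ((-1 : ℝ) ^ (i : ℕ) • T.dHat z (w i))) x := by
    rw [h1]
    exact (HasFDerivAt.fun_sum fun i _ =>
      ((hasFDerivAt_hat z (w i) x).const_mul _).mul_const _).const_mul _
  rw [h2.fderiv]
  simp only [smul_apply, sum_apply, smul_eq_mul,
    zsmul_eq_mul, Int.cast_pow, Int.cast_neg, Int.cast_one]
  rw [mul_left_comm]
  refine congrArg _ (congrArg _ (Finset.sum_congr rfl fun i _ => ?_))
  ring

theorem evalForm_whitney_eq_zero {q : ℕ} (z : T.FineCell 2) (x : T.tangent z)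
    (v : Fin q → T.tangent z) {w : T.FineCell q} (h : ¬ Set.range w ⊆ Set.range z) :
    evalForm z x v (T.whitney q w) = 0 := by
  obtain ⟨_, ⟨k, rfl⟩, hk⟩ := Set.not_subset.1 h
  rw [evalForm_whitney, Finset.sum_eq_zero, mul_zero]
  intro i _
  by_cases hik : i = k
  · rw [hik, hat_of_notMem hk]
    simp
  · obtain ⟨j, hj⟩ := Fin.exists_succAbove_eq (Ne.symm hik)
    rw [Matrix.det_eq_zero_of_row_eq_zero j, mul_zero]
    intro l
    rw [Matrix.of_apply, hj, dHat_of_notMem hk]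
    rfl

theorem evalForm_d_whitney_eq_zero {q : ℕ} (z : T.FineCell 2) (x : T.tangent z)
    (v : Fin (q + 1) → T.tangent z) {w : T.FineCell q} (h : ¬ Set.range w ⊆ Set.range z) :
    evalForm z x v (T.d q (T.whitney q w)) = 0 := by
  have h0 : (T.whitney q w z).1 = 0 :=
    funext fun y => ContinuousAlternatingMap.ext fun u => evalForm_whitney_eq_zero z y u h
  have h1 : T.whitney q w z = 0 := Subtype.ext h0
  have h2 : T.d q (T.whitney q w) z = 0 := by
    change SmoothForm.d (T.whitney q w z) = 0
    rw [h1, map_zero]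
  change (T.d q (T.whitney q w) z).1 x v = 0
  rw [h2]
  rfl

/-! ### The exterior derivative of Whitney forms as the coboundary of the refinement -/

theorem sum_fineVertex {M : Type*} [AddCommMonoid M] (z : T.FineCell 2) (F : T.FineCell 0 → M)
    (hF : ∀ w : T.FineCell 0, ¬ Set.range w ⊆ Set.range z → F w = 0) :
    ∑ w, F w = ∑ i, F (fineVertex (z i)) := by
  refine (Fintype.sum_of_injective (fun i => fineVertex (z i)) ?_ _ _ ?_ fun i => rfl).symm
  · intro i j h
    exact z.injective (congrArg (fun w : T.FineCell 0 => w 0) h)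
  · intro w hw
    refine hF w fun h => hw ?_
    obtain ⟨i, hi⟩ := h ⟨0, rfl⟩
    exact ⟨i, fineVertex_ext hi⟩

theorem sum_fineEdge {M : Type*} [AddCommMonoid M] (z : T.FineCell 2) (F : T.FineCell 1 → M)
    (hF : ∀ w : T.FineCell 1, ¬ Set.range w ⊆ Set.range z → F w = 0) :
    ∑ w, F w = ∑ i, F (z.face i) := by
  have hne : ∀ {i j : Fin 3}, z i = z j → i = j := fun h => z.injective h
  refine (Fintype.sum_of_injective (fun i => z.face i) ?_ _ _ ?_ fun i => rfl).symm
  · intro i j h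
    have h0 := congrArg (fun w : T.FineCell 1 => w 0) h
    have h1 := congrArg (fun w : T.FineCell 1 => w 1) h
    have h0' : i.succAbove 0 = j.succAbove 0 := hne h0
    have h1' : i.succAbove 1 = j.succAbove 1 := hne h1
    revert h0' h1'
    clear h0 h1 h
    revert i j
    decide
  · intro w hw
    refine hF w fun h => hw ?_
    obtain ⟨i, hi⟩ := h ⟨0, rfl⟩
    obtain ⟨j, hj⟩ := h ⟨1, rfl⟩
    have hij : i < j := by
      have := w.strictMono (show (0 : Fin 2) < 1 by decide)
      rw [← hi, ← hj] at this
      exact z.lt_iff_lt.1 this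
    have key : ∀ i j : Fin 3, i < j → ∃ k : Fin 3, k.succAbove 0 = i ∧ k.succAbove 1 = j := by
      decide
    obtain ⟨k, h0, h1⟩ := key i j hij
    refine ⟨k, fineEdge_ext ?_ ?_⟩
    · exact (congrArg z h0).trans hi
    · exact (congrArg z h1).trans hj

theorem sum_flag {M : Type*} [AddCommMonoid M] (z : T.FineCell 2) (F : T.FineCell 2 → M)
    (hF : ∀ w : T.FineCell 2, ¬ Set.range w ⊆ Set.range z → F w = 0) : ∑ w, F w = F z := by
  refine Finset.sum_eq_single z (fun w _ hw => hF w fun h => hw ?_) (by simp)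
  have : ∀ i, w i = z i := by
    intro i
    obtain ⟨j, hj⟩ := h ⟨i, rfl⟩
    have hc : (z j).1.card = (w i).1.card := by rw [hj]
    obtain ⟨z0, z1, z2⟩ := flag_card z
    obtain ⟨w0, w1, w2⟩ := flag_card w
    rw [← hj]
    congr 1
    fin_cases i <;> fin_cases j <;> simp_all
  exact flag_ext (this 0) (this 1) (this 2)

/-- On each triangle only the Whitney forms of its own faces survive. There `∑ λⱼ = 1` and `∑ dλⱼ =
0` give `dλᵢ = ∑ⱼ (λⱼ dλᵢ - λᵢ dλⱼ)`. -/
theorem d_sum_whitney_zero (r : T.FineCell 0 → ℝ) :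
    T.d 0 (∑ w, r w • T.whitney 0 w) =
      ∑ w : T.FineCell 1, (r (w.face 0) - r (w.face 1)) • T.whitney 1 w := by
  refine form_ext fun z x v => ?_
  simp only [map_sum, map_smul, smul_eq_mul]
  rw [sum_fineVertex z _ fun w hw => by rw [evalForm_d_whitney_eq_zero z x v hw, mul_zero],
    sum_fineEdge z _ fun w hw => by rw [evalForm_whitney_eq_zero z x v hw, mul_zero]]
  simp only [evalForm_d_whitney, evalForm_whitney]
  have e1 : (z.face 0).face 0 = fineVertex (z 2) := fineVertex_ext rfl
  have e2 : (z.face 0).face 1 = fineVertex (z 1) := fineVertex_ext rfl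
  have e3 : (z.face 1).face 0 = fineVertex (z 2) := fineVertex_ext rfl
  have e4 : (z.face 1).face 1 = fineVertex (z 0) := fineVertex_ext rfl
  have e5 : (z.face 2).face 0 = fineVertex (z 1) := fineVertex_ext rfl
  have e6 : (z.face 2).face 1 = fineVertex (z 0) := fineVertex_ext rfl
  have h := sum_hat z x
  have hd := sum_dHat z (v 0)
  rw [Fin.sum_univ_three] at h hd
  simp [Fin.sum_univ_three, Fin.sum_univ_two, e1, e2, e3, e4, e5, e6]
  have h2 : T.hat z (z 2) x = 1 - T.hat z (z 0) x - T.hat z (z 1) x := by linarith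
  have hd2 : T.dHat z (z 2) (v 0) = - T.dHat z (z 0) (v 0) - T.dHat z (z 1) (v 0) := by linarith
  rw [h2, hd2]
  ring

/-- Whitney `1`-forms have derivative `2 dλᵢ ∧ dλⱼ`. On a triangle these agree up to sign as `∑ dλⱼ
= 0`, and `∑ λⱼ = 1` makes the Whitney `2`-form equal to `2 dλ₀ ∧ dλ₁`. -/
theorem d_sum_whitney_one (r : T.FineCell 1 → ℝ) :
    T.d 1 (∑ w, r w • T.whitney 1 w) =
      ∑ z : T.FineCell 2, (r (z.face 0) - r (z.face 1) + r (z.face 2)) • T.whitney 2 z := by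
  refine form_ext fun z x v => ?_
  simp only [map_sum, map_smul, smul_eq_mul]
  rw [sum_fineEdge z _ fun w hw => by rw [evalForm_d_whitney_eq_zero z x v hw, mul_zero],
    sum_flag z _ fun w hw => by rw [evalForm_whitney_eq_zero z x v hw, mul_zero]]
  simp only [evalForm_d_whitney, evalForm_whitney]
  have h := sum_hat z x
  have hd := sum_dHat z (v 0)
  have hd' := sum_dHat z (v 1)
  rw [Fin.sum_univ_three] at h hd hd'
  have h2 : T.hat z (z 2) x = 1 - T.hat z (z 0) x - T.hat z (z 1) x := by linarith
  have hd2 : T.dHat z (z 2) (v 0) = - T.dHat z (z 0) (v 0) - T.dHat z (z 1) (v 0) := by linarith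
  have hd2' : T.dHat z (z 2) (v 1) = - T.dHat z (z 0) (v 1) - T.dHat z (z 1) (v 1) := by
    linarith
  have h21 : Fin.succAbove (2 : Fin 3) 1 = 1 := rfl
  simp [Fin.sum_univ_three, Fin.sum_univ_two, Matrix.det_fin_two, Fin.removeNth, h21]
  rw [h2, hd2, hd2']
  ring

theorem d_d {q : ℕ} (ω : T.Form q) : T.d (q + 1) (T.d q ω) = 0 := by
  refine funext fun z => Subtype.ext ?_
  refine extDeriv_extDeriv (SmoothForm.contDiff_coe (ω z)) ?_
  rw [minSmoothness_of_isRCLikeNormedField]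
  exact (WithTop.coe_le_coe.2 le_top : ((2 : ℕ∞) : WithTop ℕ∞) ≤ _)

/-- Three tangent vectors of a plane are linearly dependent. -/
theorem d_two (ω : T.Form 2) : T.d 2 ω = 0 := by
  refine form_ext fun z x v => ?_
  have hrank : Module.finrank ℝ (T.tangent z) = 2 := by
    have := (T.affineIndependent_point z).finrank_vectorSpan_add_one
    simpa using this
  change (T.d 2 ω z).1 x v = 0
  refine ((T.d 2 ω z).1 x).toAlternatingMap.map_linearDependent v fun h => ?_
  have := h.fintype_card_le_finrank
  rw [hrank] at this
  simp at this

/-- A triangle that contains a cell of the refinement. -/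
theorem exists_index {q : ℕ} (w : T.FineCell q) :
    ∃ (z : T.FineCell 2) (j : Fin (q + 1) → Fin 3), ∀ i, z (j i) = w i := by
  obtain ⟨p, hp⟩ := T.nonempty_of_mem_faces (w 0).2
  obtain ⟨z, -, hz⟩ := exists_flag w hp
  choose j hj using fun i => hz ⟨i, rfl⟩
  exact ⟨z, j, hj⟩

/-- The Whitney forms are linearly independent: each has its degree of freedom. -/
theorem exists_dof {q : ℕ} (w : T.FineCell q) : ∃ ℓ : T.Form q →ₗ[ℝ] ℝ,
    ∀ w', ℓ (T.whitney q w') = if w' = w then (q ! : ℝ) else 0 := by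
  obtain ⟨z, j, hj⟩ := exists_index w
  -- Evaluation at the vertex `w 0`, on the edge vectors from there to the other vertices of `w`.
  refine ⟨evalForm z (T.chartPoint z (j 0))
    fun k => T.chartPoint z (j k.succ) - T.chartPoint z (j 0), fun w' => ?_⟩
  rw [evalForm_whitney]
  simp only [dHat_sub, hat_chartPoint, hj]
  split_ifs with h
  · subst h
    rw [Finset.sum_eq_single 0]
    · have : (Matrix.of fun a b : Fin q => (if w' b.succ = w' (Fin.succAbove 0 a) then (1 : ℝ)
          else 0) - if w' 0 = w' (Fin.succAbove 0 a) then 1 else 0) = 1 := by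
        ext a b
        simp [Matrix.one_apply, eq_comm, Fin.succ_ne_zero]
      rw [this]
      simp
    · intro i _ hi
      rw [if_neg fun h => hi (w'.injective h).symm]
      simp
    · simp
  · rw [Finset.sum_eq_zero, mul_zero]
    intro i _
    by_cases hi : w 0 = w' i
    -- A vertex of `w'` other than `w' i` that is missing from `w` gives a zero row. If there is
    -- none, `w'` has the same vertices as `w`.
    · by_cases hex : ∃ a, ∀ b, w b ≠ w' (i.succAbove a)
      · obtain ⟨a, ha⟩ := hex
        rw [Matrix.det_eq_zero_of_row_eq_zero a, mul_zero]
        intro b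
        rw [Matrix.of_apply, if_neg (ha _), if_neg (ha _), sub_zero]
      · push Not at hex
        refine (h ?_).elim
        have hsub : Set.range w' ⊆ Set.range w := by
          rintro _ ⟨k, rfl⟩
          rcases Fin.eq_self_or_eq_succAbove i k with rfl | ⟨a, rfl⟩
          · exact ⟨0, hi⟩
          · exact hex a
        have hc : ∀ u : T.FineCell q, (Set.range u).ncard = q + 1 := fun u => by
          rw [← Set.image_univ, Set.ncard_image_of_injective _ u.injective, Set.ncard_univ]
          simp
        have heq := Set.eq_of_subset_of_ncard_le hsub (by rw [hc, hc]) (Set.finite_range w)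
        exact OrderEmbedding.range_inj.1 heq
    · rw [if_neg hi]
      simp

/-! ### The complex of Buffa-Christiansen forms -/

theorem d_basisForm_zero (t : T.DualCell 0) : T.d 0 (basisForm (bcCoeff T) 0 t) =
    -∑ s : T.DualCell 1, (T.incidence s.1 t.1 : ℝ) • basisForm (bcCoeff T) 1 s := by
  simp only [basisForm]
  rw [d_sum_whitney_zero]
  simp only [bcCoeff, vertexCoeff_recursion_everywhere, edgeSum, Finset.smul_sum, smul_smul,
    neg_smul, Finset.sum_neg_distrib, Finset.sum_smul]
  rw [Finset.sum_comm]

theorem d_basisForm_one (t : T.DualCell 1) : T.d 1 (basisForm (bcCoeff T) 1 t) =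
    ∑ s : T.DualCell 2, (T.incidence s.1 t.1 : ℝ) • basisForm (bcCoeff T) 2 s := by
  simp only [basisForm]
  rw [d_sum_whitney_one]
  simp only [bcCoeff, (isEdgeCoeff_edgeCoeff t).recursion', ← sum_incidence_mul_faceCoeff,
    Finset.smul_sum, smul_smul, Finset.sum_smul]
  rw [Finset.sum_comm]

theorem isEmpty_dualCell {q : ℕ} (hq : 3 ≤ q) : IsEmpty (T.DualCell q) :=
  ⟨fun v => by have := v.2.2; have := one_le_card v.2.1; omega⟩

/-- On a fine cell that starts with `v`, a form of `v'` can only be nonzero if `v ⊆ v'`, hence `v =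
v'` by dimension; the coefficient for `v` itself is nonzero by (2). -/
theorem linearIndependent_basisForm (q : ℕ) :
    LinearIndependent ℝ (basisForm (bcCoeff T) q) := by
  rw [Fintype.linearIndependent_iff]
  intro g hg v
  obtain ⟨w, hw⟩ := exists_fineCell v
  obtain ⟨ℓ, hℓ⟩ := exists_dof w
  have h := congrArg ℓ hg
  have hb : ∀ v', ℓ (basisForm (bcCoeff T) q v') = bcCoeff T q v' w * (q ! : ℝ) := by
    intro v'
    simp only [basisForm, map_sum, map_smul, smul_eq_mul, hℓ]
    simp
  simp only [map_sum, map_smul, smul_eq_mul, hb, map_zero] at h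
  rw [Finset.sum_eq_single v] at h
  · have h1 : bcCoeff T q v w ≠ 0 := by
      have hc := chainCoeff_ne_zero.2 hw
      rw [isBuffaChristiansen_bcCoeff.same_weight q v w hc]
      exact div_ne_zero (by exact_mod_cast hc) (by exact_mod_cast (dualCount_pos v).ne')
    have h2 : (q ! : ℝ) ≠ 0 := by exact_mod_cast q.factorial_ne_zero
    exact (mul_eq_zero.1 h).resolve_right (mul_ne_zero h1 h2)
  · intro v' _ hv'
    rw [isBuffaChristiansen_bcCoeff.local_support q v' w (not_isIn_or_isInBoundary.2 ?_)]
    · simp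
    · intro hsub
      have h1 := v.2.2
      have h2 := v'.2.2
      rw [hw] at hsub
      exact hv' (Subtype.ext (Finset.eq_of_subset_of_card_le hsub (by omega)).symm)
  · simp

/-- The dual cells of dimension `q` correspond to the cells of dimension `2 - q`. -/
def dualEquiv {q k : ℕ} (h : q + k = 2) : T.Cell k ≃ T.DualCell q :=
  Equiv.subtypeEquivRight fun _ => and_congr_right fun _ => by omega

variable (T) in
/-- The form with given coefficients with respect to the basis forms. -/
def dualForm {q k : ℕ} (h : q + k = 2) : (T.Cell k → ℝ) →ₗ[ℝ] T.Form q :=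
  Fintype.linearCombination ℝ fun t => basisForm (bcCoeff T) q (dualEquiv h t)

theorem dualForm_apply {q k : ℕ} (h : q + k = 2) (x : T.Cell k → ℝ) :
    dualForm T h x = ∑ t, x t • basisForm (bcCoeff T) q (dualEquiv h t) := rfl

theorem dualForm_injective {q k : ℕ} (h : q + k = 2) : Function.Injective (dualForm T h) := by
  have := (linearIndependent_basisForm (T := T) q).comp (dualEquiv h) (dualEquiv h).injective
  rw [injective_iff_map_eq_zero]
  exact fun x hx => funext (Fintype.linearIndependent_iff.1 this x hx)

theorem range_dualForm {q k : ℕ} (h : q + k = 2) :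
    LinearMap.range (dualForm T h) = bcSpace (bcCoeff T) q := by
  rw [dualForm, Fintype.range_linearCombination, bcSpace]
  congr 1
  exact (dualEquiv h).surjective.range_comp (basisForm (bcCoeff T) q)

theorem boundary_apply {k : ℕ} (x : T.Cell (k + 1) → ℝ) (s : T.Cell k) :
    T.boundary k x s = ∑ t, (T.incidence s.1 t.1 : ℝ) * x t := rfl

/-- The factor `1` matches the `-1` of `d_dualForm_zero`, so that both fit the hypothesis `D (L x) =
c • L' (M x)` of the dimension lemmas. -/
theorem d_dualForm_one (x : T.Cell 1 → ℝ) :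
    T.d 1 (dualForm T (q := 1) rfl x) = (1 : ℝ) • dualForm T (q := 2) rfl (T.boundary 0 x) := by
  rw [one_smul, dualForm_apply, dualForm_apply]
  simp only [map_sum, map_smul, d_basisForm_one, boundary_apply, Finset.smul_sum, Finset.sum_smul,
    smul_smul]
  rw [Finset.sum_comm, ← (dualEquiv (T := T) (q := 2) (k := 0) rfl).sum_comp]
  refine Finset.sum_congr rfl fun s _ => Finset.sum_congr rfl fun t _ => ?_
  rw [mul_comm]
  rfl

theorem d_dualForm_zero (x : T.Cell 2 → ℝ) :
    T.d 0 (dualForm T (q := 0) rfl x) = (-1 : ℝ) • dualForm T (q := 1) rfl (T.boundary 1 x) := by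
  rw [neg_one_smul, dualForm_apply, dualForm_apply]
  simp only [map_sum, map_smul, d_basisForm_zero, boundary_apply, Finset.smul_sum, smul_neg,
    Finset.sum_neg_distrib, Finset.sum_smul, smul_smul]
  rw [Finset.sum_comm, ← (dualEquiv (T := T) (q := 1) (k := 1) rfl).sum_comp]
  refine congrArg _ (Finset.sum_congr rfl fun s _ => Finset.sum_congr rfl fun t _ => ?_)
  rw [mul_comm]
  rfl

theorem bcSpace_eq_bot {q : ℕ} (hq : 3 ≤ q) : bcSpace (bcCoeff T) q = ⊥ := by
  have := isEmpty_dualCell (T := T) hq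
  rw [bcSpace, Set.range_eq_empty, Submodule.span_empty]

theorem d_mem_bcSpace (q : ℕ) (ω : T.Form q) (hω : ω ∈ bcSpace (bcCoeff T) q) :
    T.d q ω ∈ bcSpace (bcCoeff T) (q + 1) := by
  match q, ω, hω with
  | 0, ω, hω =>
    rw [← range_dualForm (k := 2) rfl] at hω
    obtain ⟨x, rfl⟩ := hω
    rw [d_dualForm_zero, ← range_dualForm (k := 1) rfl]
    exact Submodule.smul_mem _ _ ⟨_, rfl⟩
  | 1, ω, hω =>
    rw [← range_dualForm (k := 1) rfl] at hω
    obtain ⟨x, rfl⟩ := hω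
    rw [d_dualForm_one, ← range_dualForm (k := 0) rfl]
    exact Submodule.smul_mem _ _ ⟨_, rfl⟩
  | 2, ω, hω =>
    rw [d_two]
    exact Submodule.zero_mem _
  | q + 3, ω, hω =>
    rw [bcSpace_eq_bot (by omega), Submodule.mem_bot] at hω
    rw [hω, map_zero]
    exact Submodule.zero_mem _

/-! ### Dimensions -/

section Dimension

variable {X Y A B : Type*} [AddCommGroup X] [Module ℝ X] [AddCommGroup Y] [Module ℝ Y]
  [AddCommGroup A] [Module ℝ A] [AddCommGroup B] [Module ℝ B]

theorem finrank_map_of_injective {L : X →ₗ[ℝ] A} (hL : Function.Injective L)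
    (p : Submodule ℝ X) : Module.finrank ℝ (p.map L) = Module.finrank ℝ p :=
  (Submodule.equivMapOfInjective L hL p).finrank_eq.symm

theorem finrank_range_inf_ker {L : X →ₗ[ℝ] A} {L' : Y →ₗ[ℝ] B} (hL : Function.Injective L)
    (hL' : Function.Injective L') {D : A →ₗ[ℝ] B} {M : X →ₗ[ℝ] Y} {c : ℝ} (hc : c ≠ 0)
    (h : ∀ x, D (L x) = c • L' (M x)) :
    Module.finrank ℝ ↥(LinearMap.range L ⊓ LinearMap.ker D) =
      Module.finrank ℝ (LinearMap.ker M) := by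
  rw [← finrank_map_of_injective hL]
  suffices H : LinearMap.range L ⊓ LinearMap.ker D = (LinearMap.ker M).map L by rw [H]
  ext a
  simp only [Submodule.mem_inf, LinearMap.mem_range, LinearMap.mem_ker, Submodule.mem_map]
  constructor
  · rintro ⟨⟨x, rfl⟩, hx⟩
    refine ⟨x, hL' ?_, rfl⟩
    rw [h] at hx
    rw [map_zero]
    exact (smul_eq_zero.1 hx).resolve_left hc
  · rintro ⟨x, hx, rfl⟩
    exact ⟨⟨x, rfl⟩, by rw [h, hx, map_zero, smul_zero]⟩

theorem finrank_map_range {L : X →ₗ[ℝ] A} {L' : Y →ₗ[ℝ] B}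
    (hL' : Function.Injective L') {D : A →ₗ[ℝ] B} {M : X →ₗ[ℝ] Y} {c : ℝ} (hc : c ≠ 0)
    (h : ∀ x, D (L x) = c • L' (M x)) :
    Module.finrank ℝ ((LinearMap.range L).map D) = Module.finrank ℝ (LinearMap.range M) := by
  rw [← finrank_map_of_injective hL']
  suffices H : (LinearMap.range L).map D = (LinearMap.range M).map L' by rw [H]
  ext a
  simp only [Submodule.mem_map, LinearMap.mem_range]
  constructor
  · rintro ⟨_, ⟨x, rfl⟩, rfl⟩
    exact ⟨c • M x, ⟨c • x, map_smul _ _ _⟩, by rw [map_smul, h]⟩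
  · rintro ⟨_, ⟨x, rfl⟩, rfl⟩
    refine ⟨_, ⟨c⁻¹ • x, rfl⟩, ?_⟩
    rw [h, map_smul, map_smul, smul_smul, mul_inv_cancel₀ hc, one_smul]

theorem finrank_quotient_submoduleOf {p s : Submodule ℝ X} [FiniteDimensional ℝ p] (h : s ≤ p) :
    Module.finrank ℝ (p ⧸ s.submoduleOf p) + Module.finrank ℝ s = Module.finrank ℝ p := by
  rw [← (Submodule.submoduleOfEquivOfLe h).finrank_eq]
  exact Submodule.finrank_quotient_add_finrank _

end Dimension

/-! ### Dimensions of homology and cohomology -/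

theorem boundary_boundary (x : T.Cell 2 → ℝ) : T.boundary 0 (T.boundary 1 x) = 0 := by
  have h := d_d (dualForm T (q := 0) rfl x)
  rw [d_dualForm_zero, map_smul, d_dualForm_one, one_smul, smul_eq_zero] at h
  -- `∂ ∘ ∂ = 0` is inherited from `d ∘ d = 0` through the injective map from chains to forms.
  refine dualForm_injective (q := 2) rfl ?_
  rw [map_zero]
  exact h.resolve_left (by norm_num)

instance (q : ℕ) : FiniteDimensional ℝ (bcSpace (bcCoeff T) q) := by
  unfold bcSpace
  exact FiniteDimensional.span_of_finite ℝ (Set.finite_range _)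

instance (q : ℕ) (s : Submodule ℝ (T.Form q)) :
    FiniteDimensional ℝ ↥(bcSpace (bcCoeff T) q ⊓ s) :=
  Submodule.finiteDimensional_inf_left _ _

theorem isEmpty_cell {k : ℕ} (hk : 3 ≤ k) : IsEmpty (T.Cell k) :=
  ⟨fun v => by have := v.2.2; have := card_le_three v.2.1; omega⟩

theorem betti_zero : T.betti 0 + Module.finrank ℝ (LinearMap.range (T.boundary 0)) =
    Module.finrank ℝ (T.Cell 0 → ℝ) := by
  rw [betti, finrank_quotient_submoduleOf (p := T.cycles 0) le_top]
  exact finrank_top ℝ _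

theorem betti_one : T.betti 1 + Module.finrank ℝ (LinearMap.range (T.boundary 1)) =
    Module.finrank ℝ (LinearMap.ker (T.boundary 0)) := by
  refine finrank_quotient_submoduleOf (p := T.cycles 1) ?_
  rintro _ ⟨x, rfl⟩
  exact boundary_boundary x

theorem betti_two : T.betti 2 = Module.finrank ℝ (LinearMap.ker (T.boundary 1)) := by
  have := isEmpty_cell (T := T) (k := 3) le_rfl
  have h0 : LinearMap.range (T.boundary 2) = ⊥ := by
    rw [LinearMap.range_eq_bot]
    ext x
    exact isEmptyElim x
  have h := finrank_quotient_submoduleOf (p := T.cycles 2) (s := LinearMap.range (T.boundary 2))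
    (by rw [h0]; exact bot_le)
  rw [h0, finrank_bot, add_zero, ← h0] at h
  exact h

theorem betti_of_three_le {k : ℕ} (hk : 3 ≤ k) : T.betti k = 0 := by
  have := isEmpty_cell (T := T) hk
  exact Module.finrank_zero_of_subsingleton

/-- Forms of degree `0` correspond to `2`-chains, so this dimension is `betti 2`; its equality with
`betti 0` needs duality. -/
theorem cohomologyDim_zero : T.cohomologyDim (bcSpace (bcCoeff T)) 0 =
    Module.finrank ℝ (LinearMap.ker (T.boundary 1)) := by
  have h := finrank_quotient_submoduleOf
    (p := bcSpace (bcCoeff T) 0 ⊓ LinearMap.ker (T.d 0)) bot_le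
  rw [finrank_bot, add_zero] at h
  rw [cohomologyDim, coboundaries, h, ← range_dualForm (k := 2) rfl]
  exact finrank_range_inf_ker (dualForm_injective rfl) (dualForm_injective rfl)
    (by norm_num) d_dualForm_zero

theorem coboundaries_le (q : ℕ) : (bcSpace (bcCoeff T) q).map (T.d q) ≤
    bcSpace (bcCoeff T) (q + 1) ⊓ LinearMap.ker (T.d (q + 1)) := by
  rintro _ ⟨ω, hω, rfl⟩
  exact ⟨d_mem_bcSpace q ω hω, d_d ω⟩

theorem cohomologyDim_one : T.cohomologyDim (bcSpace (bcCoeff T)) 1 +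
    Module.finrank ℝ (LinearMap.range (T.boundary 1)) =
      Module.finrank ℝ (LinearMap.ker (T.boundary 0)) := by
  have h := finrank_quotient_submoduleOf (coboundaries_le (T := T) 0)
  rw [← finrank_range_inf_ker (dualForm_injective (T := T) (q := 1) rfl)
    (dualForm_injective (q := 2) rfl) one_ne_zero d_dualForm_one,
    ← finrank_map_range (L := dualForm T (q := 0) rfl) (dualForm_injective (T := T) (q := 1) rfl)
    (by norm_num) d_dualForm_zero, range_dualForm, range_dualForm]
  exact h

theorem cohomologyDim_two : T.cohomologyDim (bcSpace (bcCoeff T)) 2 +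
    Module.finrank ℝ (LinearMap.range (T.boundary 0)) = Module.finrank ℝ (T.Cell 0 → ℝ) := by
  have h := finrank_quotient_submoduleOf (coboundaries_le (T := T) 1)
  have hk : LinearMap.ker (T.d 2) = ⊤ := LinearMap.ker_eq_top.2 (LinearMap.ext d_two)
  have h2 : Module.finrank ℝ ↥(bcSpace (bcCoeff T) 2 ⊓ LinearMap.ker (T.d 2)) =
      Module.finrank ℝ (T.Cell 0 → ℝ) := by
    rw [hk, inf_top_eq, ← range_dualForm (k := 0) rfl]
    exact LinearMap.finrank_range_of_inj (dualForm_injective rfl)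
  rw [← h2, ← finrank_map_range (L := dualForm T (q := 1) rfl)
    (dualForm_injective (T := T) (q := 2) rfl) one_ne_zero d_dualForm_one, range_dualForm]
  exact h

theorem cohomologyDim_of_three_le {q : ℕ} (hq : 3 ≤ q) :
    T.cohomologyDim (bcSpace (bcCoeff T)) q = 0 := by
  have : Subsingleton ↥(bcSpace (bcCoeff T) q ⊓ LinearMap.ker (T.d q)) := by
    rw [bcSpace_eq_bot hq, bot_inf_eq]
    infer_instance
  exact Module.finrank_zero_of_subsingleton

/-! ### Duality of the Betti numbers -/

theorem cellSign_mul_self (s : Finset E) :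
    ((T.cellSign s : ℤ) : ℝ) * ((T.cellSign s : ℤ) : ℝ) = 1 := by
  exact_mod_cast coe_unit_mul_self (T.cellSign s)

theorem surfaceSign_mul_self (s : Finset E) :
    ((T.surfaceSign s : ℤ) : ℝ) * ((T.surfaceSign s : ℤ) : ℝ) = 1 := by
  exact_mod_cast coe_unit_mul_self (T.surfaceSign s)

theorem coboundary_apply {a b : E} (hab : a ≠ b) (e : T.Cell 1) (he : e.1 = {a, b})
    (u : T.Cell 0 → ℝ) (p p' : T.Cell 0) (hp : p.1 = {a}) (hp' : p'.1 = {b}) :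
    ∑ s : T.Cell 0, (T.incidence s.1 e.1 : ℝ) * u s =
      (T.cellSign e.1 : ℤ) * ((T.num a : ℤ) - T.num b).sign *
        ((T.cellSign p.1 : ℤ) * u p - (T.cellSign p'.1 : ℤ) * u p') := by
  have hef : ({a, b} : Finset E) ∈ T.faces := he ▸ e.2.1
  have hef' : ({b, a} : Finset E) ∈ T.faces := Finset.pair_comm a b ▸ hef
  have h1 := incidence_vertex hab hef
  have h2 := incidence_vertex hab.symm hef'
  rw [Finset.pair_comm b a, sign_sub_comm (T.num b) (T.num a)] at h2
  rw [Fintype.sum_eq_add p p']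
  · rw [hp, hp', he, h1, h2]
    push_cast
    ring
  · intro h
    rw [h, hp'] at hp
    exact hab (Finset.singleton_injective hp).symm
  · rintro s ⟨hs, hs'⟩
    rw [incidence_eq_zero, Int.cast_zero, zero_mul]
    intro hse
    obtain ⟨c, hc⟩ := Finset.card_eq_one.1 s.2.2
    have : c ∈ ({a, b} : Finset E) := by
      rw [← he]
      exact hse (by simp [hc])
    simp only [Finset.mem_insert, Finset.mem_singleton] at this
    rcases this with rfl | rfl
    · exact hs (Subtype.ext (hc.trans hp.symm))
    · exact hs' (Subtype.ext (hc.trans hp'.symm))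

/-- A cochain is closed if, up to orientation, it is constant on triangles. -/
theorem coboundary_eq_zero_iff (u : T.Cell 0 → ℝ) :
    (∀ e : T.Cell 1, ∑ s : T.Cell 0, (T.incidence s.1 e.1 : ℝ) * u s = 0) ↔
      ∀ p p' : T.Cell 0, ∀ f ∈ T.faces, p.1 ⊆ f → p'.1 ⊆ f →
        ((T.cellSign p.1 : ℤ) : ℝ) * u p = ((T.cellSign p'.1 : ℤ) : ℝ) * u p' := by
  constructor
  · intro h p p' f hf hpf hpf'
    obtain ⟨a, ha⟩ := Finset.card_eq_one.1 p.2.2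
    obtain ⟨b, hb⟩ := Finset.card_eq_one.1 p'.2.2
    by_cases hab : a = b
    · have : p = p' := Subtype.ext (by rw [ha, hb, hab])
      rw [this]
    have he : ({a, b} : Finset E) ∈ T.faces := by
      refine mem_faces_of_subset hf (fun x hx => ?_) (by simp)
      simp only [Finset.mem_insert, Finset.mem_singleton] at hx
      rcases hx with rfl | rfl
      · exact hpf (by simp [ha])
      · exact hpf' (by simp [hb])
    have h1 := h ⟨_, he, Finset.card_pair hab⟩
    rw [coboundary_apply hab _ rfl u p p' ha hb] at h1
    have hn : T.num a ≠ T.num b := num_ne he (by simp) (by simp) hab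
    have h2 : ((((T.num a : ℤ) - T.num b).sign : ℤ) : ℝ) *
        (((T.num a : ℤ) - T.num b).sign : ℤ) = 1 := by exact_mod_cast sign_sub_mul_self hn
    have h3 := cellSign_mul_self (T := T) {a, b}
    refine sub_eq_zero.1 ((mul_eq_zero.1 h1).resolve_left (mul_ne_zero ?_ ?_))
    · intro h0
      rw [h0] at h3
      simp at h3
    · intro h0
      rw [h0] at h2
      simp at h2
  · intro h e
    obtain ⟨a, b, hab, he⟩ := Finset.card_eq_two.1 e.2.2
    have ha : ({a} : Finset E) ∈ T.faces :=
      mem_faces_of_subset e.2.1 (by rw [he]; simp) (by simp)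
    have hb : ({b} : Finset E) ∈ T.faces :=
      mem_faces_of_subset e.2.1 (by rw [he]; simp) (by simp)
    rw [coboundary_apply hab e he u ⟨_, ha, rfl⟩ ⟨_, hb, rfl⟩ rfl rfl,
      h ⟨_, ha, rfl⟩ ⟨_, hb, rfl⟩ e.1 e.2.1 (by rw [he]; simp) (by rw [he]; simp), sub_self,
      mul_zero]

/-- The triangle of the mesh that contains a triangle of the refinement. -/
def facetOf (z : T.FineCell 2) : T.Cell 2 := ⟨(z 2).1, (z 2).2, (flag_card z).2.2⟩

/-- The value of a chain on a triangle with the orientation of the surface. -/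
def orientedValue (y : T.Cell 2 → ℝ) (f : T.Cell 2) : ℝ :=
  ((T.cellSign f.1 : ℤ) : ℝ) * ((T.surfaceSign f.1 : ℤ) : ℝ) * y f

theorem boundary_one_apply (y : T.Cell 2 → ℝ) {z z' : T.FineCell 2} (h0 : z 0 = z' 0)
    (h1 : z 1 = z' 1) (hne : z ≠ z') (e : T.Cell 1) (he : e.1 = (z 1).1) :
    T.boundary 1 y e = -(((T.cellSign e.1 : ℤ) : ℝ) * T.dualSign 1 (z.face 0)) *
      (orientedValue y (facetOf z) - orientedValue y (facetOf z')) := by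
  have hw : z.face 0 ≠ z'.face 0 := fun h =>
    hne (flag_ext h0 h1 (congrArg (fun w : T.FineCell 1 => w 1) h))
  have hd := dualSign_one_eq_neg (w := z.face 0) (w' := z'.face 0) (flag_card z).2.1 h1 hw
  have hi := incidence_eq_neg_dualSign (z.face 0) (flag_card z).2.1
  have hi' := incidence_eq_neg_dualSign (z'.face 0) (flag_card z').2.1
  simp only [face_two_zero_zero, face_two_zero_one] at hi hi'
  rw [boundary_apply, Fintype.sum_eq_add (facetOf z) (facetOf z')]
  · simp only [facetOf, orientedValue]
    rw [he, hi, h1, hi', hd]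
    push_cast
    ring
  · intro h
    exact hne (flag_ext h0 h1 (Subtype.ext (congrArg (fun f : T.Cell 2 => f.1) h)))
  · rintro f ⟨hf, hf'⟩
    rw [incidence_eq_zero, Int.cast_zero, zero_mul]
    intro hef
    obtain ⟨p, hp⟩ := Finset.card_eq_one.1 (flag_card z).1
    have hpz : p ∈ (z 1).1 := z.subset (show (0 : Fin 3) ≤ 1 by decide) (by simp [hp])
    obtain ⟨a, b, -, H⟩ := exists_two_flags_edge (z 1).2 (flag_card z).2.1 hpz
    obtain ⟨x, x0, x1, x2⟩ := exists_flag_of_edge_facet f.2.1 f.2.2 e.2.2 hef (he ▸ hpz)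
    have hx : x ≠ z := fun h => hf (Subtype.ext (x2.symm.trans (by rw [h]; rfl)))
    have hx' : x ≠ z' := fun h => hf' (Subtype.ext (x2.symm.trans (by rw [h]; rfl)))
    -- A third triangle at `e` would give three flags at `p` through `e`.
    have c1 := (H x).1 ⟨x0, x1.trans he⟩
    have c2 := (H z).1 ⟨hp, rfl⟩
    have c3 := (H z').1 ⟨h0 ▸ hp, by rw [h1]⟩
    grind

/-- A chain is a cycle if, with the orientation of the surface, it is constant around vertices. -/
theorem boundary_one_eq_zero_iff (y : T.Cell 2 → ℝ) : T.boundary 1 y = 0 ↔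
    ∀ z z' : T.FineCell 2, z 0 = z' 0 →
      orientedValue y (facetOf z) = orientedValue y (facetOf z') := by
  constructor
  · intro h z z' h0
    obtain ⟨p, hp⟩ := Finset.card_eq_one.1 (flag_card z).1
    refine (link_induction (P := fun x => orientedValue y (facetOf x) =
      orientedValue y (facetOf z)) hp rfl ?_ ?_ z' (h0 ▸ hp)).symm
    · intro x x' hx hx' h1 hxz
      by_cases hxx : x = x'
      · rwa [← hxx]
      have hb := congrFun h ⟨(x 1).1, (x 1).2, (flag_card x).2.1⟩
      rw [boundary_one_apply y (Subtype.ext (hx.trans hx'.symm)) h1 hxx _ rfl] at hb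
      rw [← hxz]
      refine (sub_eq_zero.1 ((mul_eq_zero.1 hb).resolve_left ?_)).symm
      refine neg_ne_zero.2 (mul_ne_zero ?_ ?_)
      · exact_mod_cast (T.cellSign (x 1).1).ne_zero
      · intro h0
        have := dualSign_one_mul_self (x.face 0) (flag_card x).2.1
        rw [Int.cast_eq_zero.1 h0] at this
        simp at this
    · intro x x' _ _ h2 hxz
      rw [← hxz]
      have : facetOf x' = facetOf x := Subtype.ext (by simp only [facetOf, h2])
      rw [this]
  · intro h
    ext e
    obtain ⟨p, hp⟩ := T.nonempty_of_mem_faces e.2.1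
    obtain ⟨z, z', hne, H⟩ := exists_two_flags_edge e.2.1 e.2.2 hp
    obtain ⟨a0, a1⟩ := (H z).2 (Or.inl rfl)
    obtain ⟨b0, b1⟩ := (H z').2 (Or.inr rfl)
    have e0 : z 0 = z' 0 := Subtype.ext (a0.trans b0.symm)
    rw [boundary_one_apply y e0 (Subtype.ext (a1.trans b1.symm)) hne e a1.symm, h z z' e0,
      sub_self, mul_zero]
    rfl

variable (T) in
/-- The coboundary operator on simplicial `0`-cochains. -/
def coboundary : (T.Cell 0 → ℝ) →ₗ[ℝ] (T.Cell 1 → ℝ) :=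
  Matrix.mulVecLin (Matrix.of fun (s : T.Cell 0) (t : T.Cell 1) =>
    (T.incidence s.1 t.1 : ℝ)).transpose

theorem mem_ker_coboundary {u : T.Cell 0 → ℝ} : u ∈ LinearMap.ker T.coboundary ↔
    ∀ p p' : T.Cell 0, ∀ f ∈ T.faces, p.1 ⊆ f → p'.1 ⊆ f →
      ((T.cellSign p.1 : ℤ) : ℝ) * u p = ((T.cellSign p'.1 : ℤ) : ℝ) * u p' := by
  rw [← coboundary_eq_zero_iff, LinearMap.mem_ker]
  exact funext_iff

theorem finrank_le_of_injOn {X Y : Type*} [AddCommGroup X] [Module ℝ X] [AddCommGroup Y]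
    [Module ℝ Y] [FiniteDimensional ℝ Y] {p : Submodule ℝ X} {s : Submodule ℝ Y} (A : X →ₗ[ℝ] Y)
    (hA : ∀ x ∈ p, A x ∈ s) (h0 : ∀ x ∈ p, A x = 0 → x = 0) :
    Module.finrank ℝ p ≤ Module.finrank ℝ s := by
  refine LinearMap.finrank_le_finrank_of_injective (f := A.restrict hA) ?_
  rw [← LinearMap.ker_eq_bot, LinearMap.ker_eq_bot']
  intro x hx
  exact Subtype.ext (h0 x x.2 (congrArg Subtype.val hx))

/-- A flag joins a vertex to a triangle, and values of locally constant functions are transferred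
along flags in both directions. Both transfers are injective on the kernels, which suffices for
equal dimensions. -/
theorem finrank_ker_coboundary : Module.finrank ℝ (LinearMap.ker T.coboundary) =
    Module.finrank ℝ (LinearMap.ker (T.boundary 1)) := by
  have hflag : ∀ f : T.Cell 2, ∃ z : T.FineCell 2, facetOf z = f := fun f => by
    obtain ⟨p, hp⟩ := T.nonempty_of_mem_faces f.2.1
    obtain ⟨z, -, hz⟩ := exists_flag_of_facet f.2.1 f.2.2 hp
    exact ⟨z, Subtype.ext hz⟩
  have hflag' : ∀ p : T.Cell 0, ∃ z : T.FineCell 2, (z 0).1 = p.1 := fun p => by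
    obtain ⟨a, ha⟩ := Finset.card_eq_one.1 p.2.2
    obtain ⟨z, hz, -⟩ := exists_flag (fineVertex ⟨p.1, p.2.1⟩) (p := a) (by simp [ha])
    exact ⟨z, hz.trans ha.symm⟩
  let vert : T.FineCell 2 → T.Cell 0 := fun z => ⟨(z 0).1, (z 0).2, (flag_card z).1⟩
  choose zf hzf using hflag
  choose zp hzp using hflag'
  have hsub : ∀ z : T.FineCell 2, (vert z).1 ⊆ (facetOf z).1 := fun z =>
    z.subset (show (0 : Fin 3) ≤ 2 by decide)
  refine le_antisymm ?_ ?_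
  -- The value on `f` is read off at the first vertex of an arbitrarily chosen flag in `f`; by `hA`
  -- the choice does not matter on the kernel.
  · let A : (T.Cell 0 → ℝ) →ₗ[ℝ] (T.Cell 2 → ℝ) := LinearMap.pi fun f =>
      (((T.cellSign f.1 : ℤ) : ℝ) * ((T.surfaceSign f.1 : ℤ) : ℝ) *
        ((T.cellSign (vert (zf f)).1 : ℤ) : ℝ)) •
        (LinearMap.proj (vert (zf f)) : (T.Cell 0 → ℝ) →ₗ[ℝ] ℝ)
    have hA : ∀ u ∈ LinearMap.ker T.coboundary, ∀ z,
        orientedValue (A u) (facetOf z) = ((T.cellSign (vert z).1 : ℤ) : ℝ) * u (vert z) := by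
      intro u hu z
      have h1 : (vert (zf (facetOf z))).1 ⊆ (facetOf z).1 := by
        have := hsub (zf (facetOf z))
        rwa [hzf] at this
      have h2 := mem_ker_coboundary.1 hu (vert (zf (facetOf z))) (vert z) _ (facetOf z).2.1 h1
        (hsub z)
      rw [← h2]
      simp only [orientedValue, A, LinearMap.pi_apply, LinearMap.smul_apply, LinearMap.proj_apply,
        smul_eq_mul]
      have h3 := cellSign_mul_self (T := T) (facetOf z).1
      have h4 := surfaceSign_mul_self (T := T) (facetOf z).1
      linear_combination ((T.cellSign (vert (zf (facetOf z))).1 : ℤ) : ℝ) *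
        u (vert (zf (facetOf z))) * (h3 * ((T.surfaceSign (facetOf z).1 : ℤ) : ℝ) ^ 2 + h4)
    refine finrank_le_of_injOn A (fun u hu => ?_) fun u hu h0 => ?_
    · rw [LinearMap.mem_ker, boundary_one_eq_zero_iff]
      intro z z' h
      have : vert z = vert z' := Subtype.ext (congrArg (fun σ : T.faces => σ.1) h)
      rw [hA u hu, hA u hu, this]
    · ext p
      have h1 := hA u hu (zp p)
      have h2 : vert (zp p) = p := Subtype.ext (hzp p)
      rw [h0, h2] at h1
      have h3 := cellSign_mul_self (T := T) p.1
      simp only [orientedValue, Pi.zero_apply, mul_zero] at h1 ⊢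
      linear_combination (-((T.cellSign p.1 : ℤ) : ℝ)) * h1 - u p * h3
  · let A : (T.Cell 2 → ℝ) →ₗ[ℝ] (T.Cell 0 → ℝ) := LinearMap.pi fun p =>
      (((T.cellSign p.1 : ℤ) : ℝ) * (((T.cellSign (facetOf (zp p)).1 : ℤ) : ℝ) *
        ((T.surfaceSign (facetOf (zp p)).1 : ℤ) : ℝ))) •
        (LinearMap.proj (facetOf (zp p)) : (T.Cell 2 → ℝ) →ₗ[ℝ] ℝ)
    have hA : ∀ y ∈ LinearMap.ker (T.boundary 1), ∀ z,
        ((T.cellSign (vert z).1 : ℤ) : ℝ) * A y (vert z) = orientedValue y (facetOf z) := by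
      intro y hy z
      rw [← (boundary_one_eq_zero_iff y).1 hy (zp (vert z)) z (Subtype.ext (hzp (vert z)))]
      simp only [orientedValue, A, LinearMap.pi_apply, LinearMap.smul_apply, LinearMap.proj_apply,
        smul_eq_mul]
      linear_combination ((T.cellSign (facetOf (zp (vert z))).1 : ℤ) : ℝ) *
        ((T.surfaceSign (facetOf (zp (vert z))).1 : ℤ) : ℝ) * y (facetOf (zp (vert z))) *
        cellSign_mul_self (T := T) (vert z).1
    refine finrank_le_of_injOn A (fun y hy => ?_) fun y hy h0 => ?_
    · rw [mem_ker_coboundary]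
      intro p p' f hf hpf hpf'
      obtain ⟨g, hg, hg3, hfg⟩ := T.exists_facet f hf
      have key : ∀ p : T.Cell 0, p.1 ⊆ f →
          ((T.cellSign p.1 : ℤ) : ℝ) * A y p = orientedValue y ⟨g, hg, hg3⟩ := by
        intro p hp
        obtain ⟨a, ha⟩ := Finset.card_eq_one.1 p.2.2
        obtain ⟨z, z0, z2⟩ := exists_flag_of_facet hg hg3 (p := a) (hfg (hp (by simp [ha])))
        have h1 := hA y hy z
        have h2 : vert z = p := Subtype.ext (z0.trans ha.symm)
        have h3 : facetOf z = ⟨g, hg, hg3⟩ := Subtype.ext z2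
        rwa [h2, h3] at h1
      rw [key p hpf, key p' hpf']
    · ext f
      have h1 := hA y hy (zf f)
      rw [h0, hzf] at h1
      simp only [orientedValue, Pi.zero_apply, mul_zero] at h1 ⊢
      have h3 := cellSign_mul_self (T := T) f.1
      have h4 := surfaceSign_mul_self (T := T) f.1
      linear_combination (-((T.cellSign f.1 : ℤ) : ℝ) * ((T.surfaceSign f.1 : ℤ) : ℝ)) * h1 -
        y f * (h3 * ((T.surfaceSign f.1 : ℤ) : ℝ) ^ 2 + h4)

/-- Poincaré duality for the Betti numbers. -/
theorem betti_zero_eq_betti_two : T.betti 0 = T.betti 2 := by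
  have h1 := betti_zero (T := T)
  have h2 := LinearMap.finrank_range_add_finrank_ker T.coboundary
  -- Equal rank of a matrix and its transpose makes `betti 0` the dimension of the kernel of
  -- `coboundary`.
  have h3 : Module.finrank ℝ (LinearMap.range T.coboundary) =
      Module.finrank ℝ (LinearMap.range (T.boundary 0)) :=
    Matrix.rank_transpose (Matrix.of fun (s : T.Cell 0) (t : T.Cell 1) =>
      (T.incidence s.1 t.1 : ℝ))
  rw [finrank_ker_coboundary, ← betti_two] at h2
  omega

theorem cohomologyDim_eq_betti (q : ℕ) :
    T.cohomologyDim (bcSpace (bcCoeff T)) q = T.betti q := by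
  match q with
  | 0 => rw [cohomologyDim_zero, ← betti_two, betti_zero_eq_betti_two]
  | 1 =>
    have h1 := cohomologyDim_one (T := T)
    have h2 := betti_one (T := T)
    omega
  | 2 =>
    have h1 := cohomologyDim_two (T := T)
    have h2 := betti_zero (T := T)
    have h3 := betti_zero_eq_betti_two (T := T)
    omega
  | q + 3 => rw [cohomologyDim_of_three_le (by omega), betti_of_three_le (by omega)]

end InterfaceMesh
end

/-! ### The complex property -/

theorem mainTheorem4 {E : Type*} [NormedAddCommGroup E] [NormedSpace ℝ E] (T : InterfaceMesh E) :
    ∃ R : T.Coefficients, T.IsBuffaChristiansen R ∧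
      (∀ R' : T.Coefficients, T.IsBuffaChristiansen R' → R' = R) ∧
      (∀ q, ∀ ω ∈ InterfaceMesh.bcSpace R q, T.d q ω ∈ InterfaceMesh.bcSpace R (q + 1)) ∧
      (∀ q, ∀ ω ∈ InterfaceMesh.bcSpace R q, T.d (q + 1) (T.d q ω) = 0) ∧
      (∀ ω ∈ InterfaceMesh.bcSpace R 2, T.d 2 ω = 0) ∧
      (∀ q, T.cohomologyDim (InterfaceMesh.bcSpace R) q = T.betti q) := by
  exact ⟨InterfaceMesh.bcCoeff T, InterfaceMesh.isBuffaChristiansen_bcCoeff,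
    fun _ hR => hR.eq_bcCoeff, InterfaceMesh.d_mem_bcSpace, fun _ ω _ => InterfaceMesh.d_d ω,
    fun ω _ => InterfaceMesh.d_two ω, InterfaceMesh.cohomologyDim_eq_betti⟩
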